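/- **Definitions.** Trees are finite, and considered up to isomorphism. Let $T$ be a tree and $k\ge 2$. A *maximal distance-$k$ independent set* ($k$-MDIS) of $T$ is an inclusion-wise maximal set of vertices in which any two distinct vertices are at distance at least $k+1$; $\mathrm{mdi}_k(T)$ is the number of $k$-MDISs of $T$. An $n$-vertex tree is *$k$-minimal* if it minimises $\mathrm{mdi}_k$ among all $n$-vertex trees. Let $f_k(n)=n$ if $n\le k+1$, and $$f_k(n)=n-\left\lfloor\frac{n-(k\bmod 2)}{\lfloor k/2\rfloor+1}\right\rfloor+1\quad\text{if } n\ge k+2.$$ Let $N_k[v]$ be the set of vertices at distance at most $k$ from $v$. A *leaf* is a vertex of degree $1$; a leaf is *diametral* if it has maximum eccentricity among all leaves. A vertex $u$ is a *$k$-twin* if $N_k[u]=N_k[v]$ for some vertex $v\ne u$, and a *diametral $k$-twin* if it is moreover a diametral leaf. A pair $(x,y)$ of vertices is *$k$-special* if $x$ and $y$ are diametral $k$-twins with $N_k[x]\neq N_k[y]$. $S_{p,m}$ is the tree on $pm+1$ vertices obtained from $p$ disjoint $m$-vertex paths by adding a new vertex and joining it to one end of each path. For $p_1,p_2\ge 1$,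 $B_{p_1,p_2,s}$ is the tree on $(p_1+p_2)s+2$ vertices consisting of two adjacent vertices that are joined to one end of each of $p_1$ and $p_2$, respectively, disjoint $s$-vertex paths; $\mathcal B_{p,s}=\{B_{p_1,p_2,s} : p_1,p_2\ge 1,\ p_1+p_2=p\}$. For a tree $T$ and $r\ge 0$, $\mathrm{Add}_k(T,r)$ (respectively $\mathrm{Add}^*_k(T,r)$) is the family of all trees with $|V(T)|+r$ vertices and of diameter $\mathrm{diam}(T)$ that contain $T$ as a subgraph and contain no diametral $k$-twin (respectively no $k$-special pair). For a family $\mathcal T$ of trees, $\mathrm{Add}_k(\mathcal T,r)=\bigcup_{T\in\mathcal T}\mathrm{Add}_k(T,r)$. **Theorem 3.** Let $k\ge 3$ be odd and $n\ge 1$. The minimum of $\mathrm{mdi}_k(T)$ over all $n$-vertex trees $T$ is $f_k(n)$; that is, every $k$-minimal $n$-vertex tree has exactly $f_k(n)$ $k$-MDISs. Put $p=\lfloor (n-1)/(\lfloor k/2\rfloor+1)\rfloor$ and $r=(n-1)\bmod(\lfloor k/2\rfloor+1)$. (i) If $n\le k+1$, then all $n$-vertex trees are $k$-minimal. (ii)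 If $n\ge k+2$ and $\lfloor k/2\rfloor+1$ divides $n-1$, then $S_{p,\lfloor k/2\rfloor+1}$ is the only $k$-minimal $n$-vertex tree. (iii) If $n\ge k+2$ and $\lfloor k/2\rfloor+1$ does not divide $n-1$, then the class of all $k$-minimal $n$-vertex trees is $$\mathrm{Add}^*_k(S_{p,\lfloor k/2\rfloor+1},r)\cup\mathrm{Add}_k(\mathcal B_{p,\lfloor k/2\rfloor+1},r-1).$$ -/

import Mathlib

namespace DistIndep

universe u v

/-- `J` is a distance-`k` independent set of the (connected) graph `G`: any two distinct vertices
of `J` are at distance at least `k + 1`. -/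
def IsDIS {V : Type u} (G : SimpleGraph V) (k : ℕ) (J : Set V) : Prop :=
  ∀ x ∈ J, ∀ y ∈ J, x ≠ y → k + 1 ≤ G.dist x y

/-- `J` is an inclusion-wise maximal distance-`k` independent set of `G`. -/
def IsMDIS {V : Type u} (G : SimpleGraph V) (k : ℕ) (J : Set V) : Prop :=
  Maximal (IsDIS G k) J

/-- The number of maximal distance-`k` independent sets of `G`. -/
noncomputable def mdi {V : Type u} (G : SimpleGraph V) (k : ℕ) : ℕ :=
  {J : Set V | IsMDIS G k J}.ncard

/-- `T` is a `k`-minimal tree: no tree with the same number of vertices has fewer maximal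
distance-`k` independent sets. (Every tree on `|V|` vertices is isomorphic to one on `V`.) -/
def IsKMinimal {V : Type u} (k : ℕ) (T : SimpleGraph V) : Prop :=
  T.IsTree ∧ ∀ T' : SimpleGraph V, T'.IsTree → mdi T k ≤ mdi T' k

/-- The function `f_k(n)`. -/
def f (k n : ℕ) : ℕ :=
  if n ≤ k + 1 then n else n - (n - k % 2) / (k / 2 + 1) + 1

/-- The set `N_k[v]` of the vertices at distance at most `k` from `v` in the (connected)
graph `G`. -/
def closedNbhd {V : Type u} (G : SimpleGraph V) (k : ℕ) (v : V) : Set V :=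
  {w | G.dist v w ≤ k}

/-- A leaf is a vertex of degree one. -/
def IsLeaf {V : Type u} (G : SimpleGraph V) (v : V) : Prop :=
  (G.neighborSet v).ncard = 1

/-- A diametral leaf is a leaf of maximum eccentricity among all leaves. -/
def IsDiametralLeaf {V : Type u} (G : SimpleGraph V) (v : V) : Prop :=
  IsLeaf G v ∧ ∀ w, IsLeaf G w → G.eccent w ≤ G.eccent v

/-- `x` is a `k`-twin: some other vertex has the same closed `k`-neighbourhood. -/
def IsTwin {V : Type u} (G : SimpleGraph V) (k : ℕ) (x : V) : Prop :=
  ∃ y, y ≠ x ∧ closedNbhd G k x = closedNbhd G k y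

/-- `x` is a diametral `k`-twin: a diametral leaf that is a `k`-twin. -/
def IsDiametralTwin {V : Type u} (G : SimpleGraph V) (k : ℕ) (x : V) : Prop :=
  IsDiametralLeaf G x ∧ IsTwin G k x

/-- `(x, y)` is a `k`-special pair: two diametral leaves that are both `k`-twins and have
different closed `k`-neighbourhoods. -/
def IsSpecialPair {V : Type u} (G : SimpleGraph V) (k : ℕ) (x y : V) : Prop :=
  IsDiametralTwin G k x ∧ IsDiametralTwin G k y ∧ closedNbhd G k x ≠ closedNbhd G k y

/-- The members of `Add_k(T, r)` with vertex set `V`: the trees with `r` more vertices than `T`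
and of the same diameter as `T` that contain (a copy of) `T` as a subgraph and have no diametral
`k`-twin. -/
def Add {W : Type v} (V : Type u) (k : ℕ) (T : SimpleGraph W) (r : ℕ) : Set (SimpleGraph V) :=
  {T' | T'.IsTree ∧ Nat.card V = Nat.card W + r ∧ T'.diam = T.diam ∧ T.IsContained T' ∧
    ¬ ∃ x, IsDiametralTwin T' k x}

/-- The members of `Add*_k(T, r)` with vertex set `V`: the trees with `r` more vertices than `T`
and of the same diameter as `T` that contain (a copy of) `T` as a subgraph and have no `k`-special
pair. -/
def AddStar {W : Type v} (V : Type u) (k : ℕ) (T : SimpleGraph W) (r : ℕ) :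
    Set (SimpleGraph V) :=
  {T' | T'.IsTree ∧ Nat.card V = Nat.card W + r ∧ T'.diam = T.diam ∧ T.IsContained T' ∧
    ¬ ∃ x y, IsSpecialPair T' k x y}

/-- The star-like tree `S_{p,m}`: disjoint paths `(i, 0), …, (i, m - 1)`, for `i < p`, and a new
vertex `none` joined to the end `(i, 0)` of each of them. -/
def starLike (p m : ℕ) : SimpleGraph (Option (Fin p × Fin m)) :=
  SimpleGraph.fromRel fun x y =>
    match x, y with
    | none, some b => (b.2 : ℕ) = 0
    | some a, some b => a.1 = b.1 ∧ (a.2 : ℕ) + 1 = (b.2 : ℕ)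
    | _, none => False

/-- The tree `B_{p₁,p₂,s}`: two adjacent central vertices, joined to one end of each of `p₁` and
`p₂` disjoint paths on `s` vertices, respectively. -/
def doubleStarLike (p₁ p₂ s : ℕ) :
    SimpleGraph (Option (Fin p₁ × Fin s) ⊕ Option (Fin p₂ × Fin s)) :=
  (starLike p₁ s).sum (starLike p₂ s) ⊔ SimpleGraph.edge (Sum.inl none) (Sum.inr none)

/-- The members of `Add_k(𝓑_{p,s}, r)` with vertex set `V`, where `𝓑_{p,s}` is the family of all
trees `B_{p₁,p₂,s}` with `p₁, p₂ ≥ 1` and `p₁ + p₂ = p`. -/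
def AddB (V : Type u) (k p s r : ℕ) : Set (SimpleGraph V) :=
  {T' | ∃ p₁ p₂ : ℕ, 1 ≤ p₁ ∧ 1 ≤ p₂ ∧ p₁ + p₂ = p ∧ T' ∈ Add V k (doubleStarLike p₁ p₂ s) r}

end DistIndep

/-! Write `k + 1 = 2 * s`, so that two vertices may lie in a common independent set when their
distance is at least `2 * s`. For `n ≥ k + 2` the number `f_k(n)` is then `n - ⌊(n - 1) / s⌋ + 1`.
Everything about distances is derived from the four-point condition and the evenness of triangle
perimeters. Subtrees become vertex sets closed under geodesics, with the ambient metric, which makes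
induction by deleting vertices painless.

Two counting facts carry the proof. If `L` is a maximal independent set and no two vertices outside
`L` are far apart, there are exactly `n - |L| + 1` maximal sets: `L`, and for each `u ∉ L` the set
of `u` and the points of `L` far from `u` (`card_maxSpreads_of_split`). On passing to a subset `S'`,
distinct maximal sets of `S'` extend to distinct maximal sets of `S`, and each maximal set of `S`
whose trace on `S'` is not maximal is an additional one (`card_maxSpreads_add_card_le`).

If the diameter is below `2 * s`, the maximal sets are the `n` singletons. At diameter `2 * s`
without special pairs, or `2 * s + 1` without diametral twins, the split count applies. Disjoint
balls of radius `s - 1` around the points of `L` give `|L| * s + 1 ≤ n`, or `|L| * s + 2 ≤ n` at the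
odd diameter (`packing`, `packing_odd`), hence the bound. In all other cases strict inequality is
proved by induction, deleting an end of a diametral path or a whole branch and counting the lost
maximal sets (`boundHolds`).

Equality therefore forces one of the two tame cases with `|L| = ⌊(n - 1) / s⌋`. Geodesics from the
centre, respectively from the central edge, to the points of `L` form the required star-like or
double star-like subtree. Conversely, the ends of the arms of such a subtree are a maximal set to
which the split count applies. -/

namespace DistIndep

open Finset

/-! ### Counting maximal spread sets of an abstract relation -/

section Mis

variable {V : Type*} {far : V → V → Prop} {S S' J L : Finset V}

/-- Any two distinct elements of `J` are related by `far`. -/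
def Spread (far : V → V → Prop) (J : Finset V) : Prop :=
  ∀ x ∈ J, ∀ y ∈ J, x ≠ y → far x y

/-- `J` is an inclusion-wise maximal `far`-spread subset of `S`. -/
structure IsMaxSpread (far : V → V → Prop) (S J : Finset V) : Prop where
  subset : J ⊆ S
  spread : Spread far J
  exists_not_far : ∀ x ∈ S, x ∉ J → ∃ y ∈ J, ¬ far x y

open Classical in
/-- The finset of all maximal `far`-spread subsets of `S`. -/
noncomputable def maxSpreads (far : V → V → Prop) (S : Finset V) : Finset (Finset V) :=
  S.powerset.filter (IsMaxSpread far S)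

theorem mem_maxSpreads : J ∈ maxSpreads far S ↔ IsMaxSpread far S J := by
  simp only [maxSpreads, mem_filter, mem_powerset, and_iff_right_iff_imp]
  exact fun h => h.subset

open Classical in
theorem Spread.exists_isMaxSpread_superset (hsymm : ∀ x y, far x y → far y x) (hJ : Spread far J)
    (hJS : J ⊆ S) : ∃ I, J ⊆ I ∧ IsMaxSpread far S I := by
  obtain ⟨I, hI, hmax⟩ := (S.powerset.filter (fun I => J ⊆ I ∧ Spread far I)).exists_max_image
    card ⟨J, by simp [hJS, hJ]⟩
  simp only [mem_filter, mem_powerset] at hI hmax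
  refine ⟨I, hI.2.1, hI.1, hI.2.2, fun x hx hxI => ?_⟩
  by_contra! hcon
  have := hmax (insert x I) ⟨insert_subset hx hI.1, hI.2.1.trans (subset_insert _ _), ?_⟩
  · rw [card_insert_of_notMem hxI] at this
    omega
  · intro a ha b hb hab
    rw [mem_insert] at ha hb
    rcases ha with rfl | ha <;> rcases hb with rfl | hb
    · exact absurd rfl hab
    · exact hcon b hb
    · exact hsymm _ _ (hcon a ha)
    · exact hI.2.2 a ha b hb hab

open Classical in
/-- Passing to a subset does not increase the number of maximal spread sets, and every maximal
spread set whose trace is not maximal is lost. -/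
theorem card_maxSpreads_add_card_le (hsymm : ∀ x y, far x y → far y x) (hirr : ∀ x, ¬ far x x)
    (hS : S' ⊆ S) (F : Finset (Finset V)) (hF : ∀ I ∈ F, IsMaxSpread far S I)
    (hF' : ∀ I ∈ F, ∃ z ∈ S', ∀ y ∈ I, y ∈ S' → far z y) :
    (maxSpreads far S').card + F.card ≤ (maxSpreads far S).card := by
  have key : ∀ J : Finset V, ∃ I, J ∈ maxSpreads far S' → J ⊆ I ∧ IsMaxSpread far S I := by
    intro J
    by_cases hJ : J ∈ maxSpreads far S'
    · have hJ' := mem_maxSpreads.1 hJ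
      obtain ⟨I, h⟩ := hJ'.spread.exists_isMaxSpread_superset hsymm (hJ'.subset.trans hS)
      exact ⟨I, fun _ => h⟩
    · exact ⟨∅, fun h => absurd h hJ⟩
  choose e he using key
  have trace : ∀ J ∈ maxSpreads far S', (e J).filter (· ∈ S') = J := by
    intro J hJ
    have hJ' := mem_maxSpreads.1 hJ
    ext x
    simp only [mem_filter]
    refine ⟨fun ⟨hx, hxS⟩ => ?_, fun hx => ⟨(he J hJ).1 hx, hJ'.subset hx⟩⟩
    by_contra hxJ
    obtain ⟨y, hy, hxy⟩ := hJ'.exists_not_far x hxS hxJ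
    exact hxy ((he J hJ).2.spread x hx y ((he J hJ).1 hy) (by rintro rfl; exact hxJ hy))
  have hinj : Set.InjOn e (maxSpreads far S') := by
    intro J hJ K hK h
    rw [← trace J hJ, ← trace K hK, h]
  -- The extension `e J` has trace `J`, which is maximal in `S'`; a member of `F` leaves room in
  -- `S'` for `z`.
  have hdisj : Disjoint ((maxSpreads far S').image e) F := by
    rw [disjoint_left]
    intro I hI hIF
    obtain ⟨J, hJ, rfl⟩ := mem_image.1 hI
    obtain ⟨z, hz, hzy⟩ := hF' _ hIF
    have hJ' := mem_maxSpreads.1 hJ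
    by_cases hzJ : z ∈ J
    · exact hirr z (hzy z ((he J hJ).1 hzJ) hz)
    · obtain ⟨y, hy, hzy'⟩ := hJ'.exists_not_far z hz hzJ
      exact hzy' (hzy y ((he J hJ).1 hy) (hJ'.subset hy))
  rw [← card_image_of_injOn hinj, ← card_union_of_disjoint hdisj]
  refine card_le_card (union_subset ?_ ?_)
  · intro I hI
    obtain ⟨J, hJ, rfl⟩ := mem_image.1 hI
    exact mem_maxSpreads.2 (he J hJ).2
  · exact fun I hI => mem_maxSpreads.2 (hF I hI)

open Classical in
/-- If `S` splits into a maximal spread set `L` and a set without any `far` pair, then `S` has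
exactly `|S| - |L| + 1` maximal spread sets. -/
theorem card_maxSpreads_of_split (hsymm : ∀ x y, far x y → far y x)
    (hL : IsMaxSpread far S L) (hC : ∀ x ∈ S, x ∉ L → ∀ y ∈ S, y ∉ L → ¬ far x y) :
    (maxSpreads far S).card = S.card - L.card + 1 := by
  -- A maximal set through `u ∉ L` contains no other point outside `L`, so this is the only
  -- candidate.
  let N : V → Finset V := fun u => insert u (L.filter (far u))
  have hN : ∀ u ∈ S, u ∉ L → IsMaxSpread far S (N u) := by
    intro u hu huL
    refine ⟨insert_subset hu ((filter_subset _ _).trans hL.subset), ?_, ?_⟩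
    · intro a ha b hb hab
      simp only [N, mem_insert, mem_filter] at ha hb
      rcases ha with rfl | ha <;> rcases hb with rfl | hb
      · exact absurd rfl hab
      · exact hb.2
      · exact hsymm _ _ ha.2
      · exact hL.spread a ha.1 b hb.1 hab
    · intro x hx hxN
      simp only [N, mem_insert, mem_filter, not_or, not_and] at hxN
      refine ⟨u, mem_insert_self _ _, fun h => ?_⟩
      by_cases hxL : x ∈ L
      · exact hxN.2 hxL (hsymm _ _ h)
      · exact hC x hx hxL u hu huL h
  have himg : maxSpreads far S = insert L ((S \ L).image N) := by
    ext J
    rw [mem_maxSpreads, mem_insert, mem_image]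
    constructor
    · intro hJ
      by_cases hJL : J ⊆ L
      · left
        refine hJL.antisymm fun x hx => ?_
        by_contra hxJ
        obtain ⟨y, hy, hxy⟩ := hJ.exists_not_far x (hL.subset hx) hxJ
        exact hxy (hL.spread x hx y (hJL hy) (by rintro rfl; exact hxJ hy))
      · right
        obtain ⟨u, huJ, huL⟩ := not_subset.1 hJL
        have huS := hJ.subset huJ
        refine ⟨u, mem_sdiff.2 ⟨huS, huL⟩, ?_⟩
        have hsub : J ⊆ N u := by
          intro x hx
          by_cases hxu : x = u
          · exact hxu ▸ mem_insert_self _ _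
          · have hfar := hJ.spread u huJ x hx (Ne.symm hxu)
            refine mem_insert_of_mem (mem_filter.2 ⟨?_, hfar⟩)
            by_contra hxL
            exact hC u huS huL x (hJ.subset hx) hxL hfar
        refine Subset.antisymm (fun x hx => ?_) hsub
        by_contra hxJ
        obtain ⟨y, hy, hxy⟩ := hJ.exists_not_far x ((hN u huS huL).subset hx) hxJ
        exact hxy ((hN u huS huL).spread x hx y (hsub hy) (by rintro rfl; exact hxJ hy))
    · rintro (rfl | ⟨u, hu, rfl⟩)
      · exact hL
      · rw [mem_sdiff] at hu
        exact hN u hu.1 hu.2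
  have hnot : L ∉ (S \ L).image N := by
    intro h
    obtain ⟨u, hu, h⟩ := mem_image.1 h
    exact (mem_sdiff.1 hu).2 (h ▸ mem_insert_self u _)
  have hinj : Set.InjOn N ((S \ L : Finset V) : Set V) := by
    intro u hu w hw h
    simp only [coe_sdiff, Set.mem_sdiff, mem_coe] at hu hw
    have : u ∈ N w := h ▸ mem_insert_self u _
    simp only [N, mem_insert, mem_filter] at this
    exact this.resolve_right fun h => hu.2 h.1
  rw [himg, card_insert_of_notMem hnot, card_image_of_injOn hinj, card_sdiff_of_subset hL.subset]

end Mis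

/-! ### Tree metrics, ball packing and twins -/

/-- An integral tree metric: a metric that satisfies the four-point condition and in which every
triangle has even perimeter. -/
structure IsTreeMetric {V : Type*} (d : V → V → ℕ) : Prop where
  self : ∀ x, d x x = 0
  eq_of_zero : ∀ x y, d x y = 0 → x = y
  symm : ∀ x y, d x y = d y x
  tri : ∀ x y z, d x z ≤ d x y + d y z
  fourPoint : ∀ x y z w, d x y + d z w ≤ max (d x z + d y w) (d x w + d y z)
  even : ∀ x y z, ∃ m, d x y + d y z + d x z = 2 * m

/-- `S` contains with any two points a geodesic between them. -/
def IsGeodesic {V : Type*} (d : V → V → ℕ) (S : Finset V) : Prop :=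
  ∀ x ∈ S, ∀ y ∈ S, ∀ i ≤ d x y, ∃ z ∈ S, d x z = i ∧ i + d z y = d x y

/-- Being at distance at least `2 * s`. -/
def Far {V : Type*} (d : V → V → ℕ) (s : ℕ) (x y : V) : Prop := 2 * s ≤ d x y

section Metric

variable {V : Type*} {d : V → V → ℕ} {S L : Finset V} {s : ℕ}

theorem IsTreeMetric.far_symm (hd : IsTreeMetric d) (x y : V) (h : Far d s x y) : Far d s y x := by
  unfold Far at *
  rwa [hd.symm]

theorem IsTreeMetric.not_far_self (hd : IsTreeMetric d) (hs : 1 ≤ s) (x : V) : ¬ Far d s x x := by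
  unfold Far
  rw [hd.self]
  omega

/-- The distance to a point of a geodesic. -/
theorem IsTreeMetric.dist_between (hd : IsTreeMetric d) {x y m : V} (h : d x m + d m y = d x y)
    (z : V) : d z m + d x m ≥ d z x ∧ d z m + d m y ≥ d z y ∧
      (d z m + d x m = d z x ∨ d z m + d m y = d z y) := by
  have h1 := hd.fourPoint x y z m
  have h2 := hd.tri z m x
  have h3 := hd.tri z m y
  have h4 := hd.symm x m
  have h5 := hd.symm y m
  have h6 := hd.symm x z
  have h7 := hd.symm y z
  have h8 := hd.symm m z
  omega

theorem IsTreeMetric.pos (hd : IsTreeMetric d) {x y : V} (h : x ≠ y) : 0 < d x y := by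
  rcases Nat.eq_zero_or_pos (d x y) with h0 | h0
  · exact absurd (hd.eq_of_zero _ _ h0) h
  · exact h0

theorem IsTreeMetric.ne (hd : IsTreeMetric d) {x y : V} (h : 0 < d x y) : x ≠ y := by
  rintro rfl
  rw [hd.self] at h
  omega

-- The first `s` points of a geodesic starting at `x` already lie in the ball. This is the mass of
-- each ball in the packing bound.
open Classical in
theorem IsGeodesic.card_ball (hd : IsTreeMetric d) (hS : IsGeodesic d S) {x y : V} (hx : x ∈ S)
    (hy : y ∈ S) (hxy : s ≤ d x y + 1) : s ≤ (S.filter (fun u => d u x < s)).card := by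
  have : (range s).card ≤ (S.filter (fun u => d u x < s)).card := by
    have key : ∀ i, ∃ z, i ∈ range s → z ∈ S ∧ d x z = i := by
      intro i
      by_cases hi : i ∈ range s
      · obtain ⟨z, hz, h, -⟩ := hS x hx y hy i (by rw [mem_range] at hi; omega)
        exact ⟨z, fun _ => ⟨hz, h⟩⟩
      · exact ⟨x, fun h => absurd h hi⟩
    choose e he using key
    refine card_le_card_of_injOn e ?_ ?_
    · intro i hi
      have := he i (by simpa using hi)
      have h2 := hd.symm (e i) x
      simp only [coe_range, Set.mem_Iio] at hi
      simp only [coe_filter, Set.mem_ofPred_eq]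
      exact ⟨this.1, by omega⟩
    · intro i hi j hj h
      rw [← (he i (by simpa using hi)).2, ← (he j (by simpa using hj)).2, h]
  simpa using this

open Classical in
/-- Disjoint balls of radius `s - 1` around the points of a `2s`-separated set; `U` is a set of
points outside of them. -/
theorem packing_aux (hd : IsTreeMetric d) (hS : IsGeodesic d S) (hLS : L ⊆ S)
    (hL : Spread (Far d s) L) (hL2 : 2 ≤ L.card) {U : Finset V} (hU : U ⊆ S)
    (hUL : ∀ u ∈ U, ∀ l ∈ L, s ≤ d u l) : L.card * s + U.card ≤ S.card := by
  have hdisj : (L : Set V).PairwiseDisjoint (fun l => S.filter (fun u => d u l < s)) := by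
    intro l hl l' hl' hne
    simp only [Function.onFun, disjoint_left, mem_filter]
    rintro u ⟨-, h1⟩ ⟨-, h2⟩
    have h3 := hL l hl l' hl' hne
    unfold Far at h3
    have h4 := hd.tri l u l'
    have h5 := hd.symm l u
    omega
  have hU' : Disjoint (L.biUnion fun l => S.filter (fun u => d u l < s)) U := by
    rw [disjoint_left]
    intro u hu huU
    obtain ⟨l, hl, hu⟩ := mem_biUnion.1 hu
    have := hUL u huU l hl
    have := (mem_filter.1 hu).2
    omega
  calc L.card * s + U.card ≤ (∑ l ∈ L, (S.filter (fun u => d u l < s)).card) + U.card := by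
        rw [← smul_eq_mul]
        refine Nat.add_le_add_right (card_nsmul_le_sum _ _ _ fun l hl => ?_) _
        obtain ⟨l', hl', hne⟩ := exists_mem_ne (show 1 < L.card by omega) l
        refine hS.card_ball hd (hLS hl) (hLS hl') ?_
        have h3 := hL l hl l' hl' hne.symm
        unfold Far at h3
        omega
    _ ≤ S.card := by
        rw [← card_biUnion hdisj, ← card_union_of_disjoint hU']
        refine card_le_card (union_subset (biUnion_subset.2 fun l _ => filter_subset _ _) hU)

/-- A point at distance `s` from `l` on a geodesic to another point of a `2s`-separated set is at
distance at least `s` from the whole set. -/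
theorem exists_outside (hd : IsTreeMetric d) (hS : IsGeodesic d S) (hLS : L ⊆ S)
    (hL : Spread (Far d s) L) {l l' : V} (hl : l ∈ L) (hl' : l' ∈ L) (hne : l ≠ l') :
    ∃ c ∈ S, d l c = s ∧ d l c + d c l' = d l l' ∧ ∀ x ∈ L, s ≤ d c x := by
  have h := hL l hl l' hl' hne
  unfold Far at h
  obtain ⟨c, hc, h1, h2⟩ := hS l (hLS hl) l' (hLS hl') s (by omega)
  refine ⟨c, hc, h1, by omega, fun x hx => ?_⟩
  by_cases hxl : l = x
  · subst hxl
    have := hd.symm c l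
    omega
  · have h3 := hL l hl x hx hxl
    unfold Far at h3
    have := hd.tri l c x
    omega

/-- Each of the disjoint balls holds at least `s` points, and a geodesic between two of the centres
leaves them: this accounts for the extra point. -/
theorem packing (hd : IsTreeMetric d) (hS : IsGeodesic d S) (hLS : L ⊆ S)
    (hL : Spread (Far d s) L) (hL2 : 2 ≤ L.card) : L.card * s + 1 ≤ S.card := by
  classical
  obtain ⟨l, hl, l', hl', hne⟩ := one_lt_card.1 (show 1 < L.card by omega)
  obtain ⟨c, hc, -, -, h⟩ := exists_outside hd hS hLS hL hl hl' hne
  have := packing_aux hd hS hLS hL hL2 (U := {c}) (by simpa using hc)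
    (by simpa using h)
  simpa using this

/-- On a geodesic of length `2 * s + 1` the points at distance `s` from either end are distinct, and
both avoid all the balls. They become the two centres of the double star-like tree. -/
theorem packing_odd (hd : IsTreeMetric d) (hS : IsGeodesic d S) (hLS : L ⊆ S)
    (hL : Spread (Far d s) L) {l l' : V} (hl : l ∈ L) (hl' : l' ∈ L) (hll : d l l' = 2 * s + 1) :
    L.card * s + 2 ≤ S.card := by
  classical
  have hne : l ≠ l' := hd.ne (by omega)
  have hL2 : 2 ≤ L.card := one_lt_card.2 ⟨l, hl, l', hl', hne⟩
  obtain ⟨c, hc, h1, h2, h⟩ := exists_outside hd hS hLS hL hl hl' hne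
  obtain ⟨c', hc', h1', h2', h'⟩ := exists_outside hd hS hLS hL hl' hl hne.symm
  have hcc : c ≠ c' := by
    rintro rfl
    have := hd.symm l' l
    have := hd.symm c l
    omega
  have := packing_aux hd hS hLS hL hL2 (U := {c, c'})
    (by simp [insert_subset_iff, hc, hc']) (by simp; exact ⟨h, h'⟩)
  rwa [card_pair hcc] at this

/-- Vertices of maximum eccentricity that are close to each other see the same far points. -/
theorem IsTreeMetric.far_of_twin (hd : IsTreeMetric d) {D : ℕ} (hD : 2 * s ≤ D)
    (hmax : ∀ x ∈ S, ∀ y ∈ S, d x y ≤ D) {v v' w w' : V} (hv : v ∈ S)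
    (hv' : v' ∈ S) (hw : w ∈ S) (hw' : w' ∈ S) (hvw : d v w = D) (hvw' : d v' w' = D)
    (hvv : d v v' < 2 * s) : d v' w = D ∧ ∀ y ∈ S, 2 * s ≤ d y v → 2 * s ≤ d y v' := by
  -- Since `d v v' < 2 * s ≤ D`, the pairing that contains `d v v'` cannot dominate. Hence `d v' w =
  -- D`. The same argument with `y` in place of `w'` shows that `v'` is at least as far from `y` as
  -- `v` is.
  have h1 := hd.fourPoint v w v' w'
  have h2 := hmax w hw w' hw'
  have h3 := hmax v hv w' hw'
  have h4 := hmax v' hv' w hw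
  have h5 := hd.symm w v'
  have h6 : d v' w = D := by omega
  refine ⟨h6, fun y hy hyv => ?_⟩
  have h7 := hd.fourPoint y v v' w
  have h8 := hmax y hy w hw
  omega

/-- Removing a point of maximum eccentricity. -/
theorem IsGeodesic.erase [DecidableEq V] (hd : IsTreeMetric d) (hS : IsGeodesic d S)
    {v w : V} (hv : v ∈ S) (hw : w ∈ S) (hmax : ∀ x ∈ S, ∀ y ∈ S, d x y ≤ d v w) :
    IsGeodesic d (S.erase v) := by
  intro x hx y hy i hi
  rw [mem_erase] at hx hy
  obtain ⟨z, hz, h1, h2⟩ := hS x hx.2 y hy.2 i hi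
  refine ⟨z, mem_erase.2 ⟨?_, hz⟩, h1, h2⟩
  rintro rfl
  -- If the deleted end were interior to a geodesic from `x` to `y`, then `x` or `y` would be
  -- farther from `w` than it is.
  have h3 := hd.fourPoint x y z w
  have h4 := hmax x hx.2 w hw
  have h5 := hmax y hy.2 w hw
  have h6 := hd.pos hx.1
  have h7 := hd.pos hy.1
  have h8 := hd.symm y z
  omega

end Metric

/-! ### Diametral points, exact counts and deletion steps -/

/-- `v` is a point of `S` that has another point of `S` at distance exactly `D`. -/
def Reaches {V : Type*} (d : V → V → ℕ) (S : Finset V) (D : ℕ) (v : V) : Prop :=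
  v ∈ S ∧ ∃ w ∈ S, d v w = D

/-- Distinct points that reach `D` are at distance at least `2 * s`. -/
def TwinFree {V : Type*} (d : V → V → ℕ) (S : Finset V) (s D : ℕ) : Prop :=
  ∀ v v', Reaches d S D v → Reaches d S D v' → d v v' < 2 * s → v = v'

/-- There are no two pairs of close points reaching `D` that are far from each other. -/
def SpecialFree {V : Type*} (d : V → V → ℕ) (S : Finset V) (s D : ℕ) : Prop :=
  ∀ v v' u u', Reaches d S D v → Reaches d S D v' → Reaches d S D u → Reaches d S D u' →
    v ≠ v' → u ≠ u' → d v v' < 2 * s → d u u' < 2 * s → d u v < 2 * s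

/-- `D` is the maximum distance between points of `S`. -/
structure HasDiam {V : Type*} (d : V → V → ℕ) (S : Finset V) (D : ℕ) : Prop where
  le : ∀ x ∈ S, ∀ y ∈ S, d x y ≤ D
  exists_eq : ∃ x ∈ S, ∃ y ∈ S, d x y = D

/-- The lower bound `n - ⌊(n - 1) / s⌋ + 1`. -/
def lowerBound (s n : ℕ) : ℕ := n - (n - 1) / s + 1

theorem lowerBound_le_succ (s n : ℕ) (hn : 1 ≤ n) :
    lowerBound s n ≤ lowerBound s (n - 1) + 1 := by
  unfold lowerBound
  have h1 : (n - 1 - 1) / s ≤ (n - 1) / s := Nat.div_le_div_right (by omega)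
  have h2 : (n - 1) / s ≤ n - 1 := Nat.div_le_self _ _
  omega

/-- The quotient drops by at least one when `b ≥ s` vertices go. Deleting a branch of `b` vertices
thus requires only `b - 1` lost maximal sets. -/
theorem lowerBound_add_one_le (s n b : ℕ) (hs : 1 ≤ s) (hb : s ≤ b) (hbn : b < n) :
    lowerBound s n + 1 ≤ lowerBound s (n - b) + b := by
  unfold lowerBound
  have h1 : (n - b - 1) / s + 1 ≤ (n - 1) / s := by
    rw [← Nat.add_div_right _ (by omega)]
    exact Nat.div_le_div_right (by omega)
  have h2 : (n - 1) / s ≤ n - 1 := Nat.div_le_self _ _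
  have h3 : (n - b - 1) / s ≤ n - b - 1 := Nat.div_le_self _ _
  omega

theorem lowerBound_le_of_mul_lt (s n q : ℕ) (hs : 1 ≤ s) (h : q * s + 1 ≤ n) :
    lowerBound s n ≤ n - q + 1 := by
  unfold lowerBound
  have : q ≤ (n - 1) / s := (Nat.le_div_iff_mul_le (by omega)).2 (by omega)
  omega

section Bound

variable {V : Type*} {d : V → V → ℕ} {S L : Finset V} {s D : ℕ}

/-- Two far points outside `L` would both reach the diameter, and maximality of `L` gives each of
them a close partner in `L`, which reaches it as well. Those are two pairs of twins far from each
other, which `SpecialFree` forbids. -/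
theorem card_maxSpreads_even (hd : IsTreeMetric d) (hS : HasDiam d S (2 * s))
    (hsp : SpecialFree d S s (2 * s)) (hL : IsMaxSpread (Far d s) S L) (hL2 : 2 ≤ L.card) :
    (maxSpreads (Far d s) S).card = S.card - L.card + 1 := by
  refine card_maxSpreads_of_split hd.far_symm hL fun u hu huL w hw hwL h => ?_
  have reach : ∀ l ∈ L, Reaches d S (2 * s) l := by
    intro l hl
    obtain ⟨l', hl', hne⟩ := exists_mem_ne (show 1 < L.card by omega) l
    have h1 := hL.spread l hl l' hl' hne.symm
    exact ⟨hL.subset hl, l', hL.subset hl', le_antisymm (hS.le _ (hL.subset hl) _ (hL.subset hl')) h1⟩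
  obtain ⟨l, hl, hul⟩ := hL.exists_not_far u hu huL
  obtain ⟨l', hl', hwl⟩ := hL.exists_not_far w hw hwL
  unfold Far at h hul hwl
  have huw := le_antisymm (hS.le _ hu _ hw) h
  have := hsp u l w l' ⟨hu, w, hw, huw⟩ (reach l hl) ⟨hw, u, hu, by rw [hd.symm, huw]⟩
    (reach l' hl') (by rintro rfl; exact huL hl) (by rintro rfl; exact hwL hl') (by omega)
    (by omega)
  have := hd.symm u w
  omega

/-- By parity every point of `L` is at distance exactly `2 * s + 1` from `a` or from `b`. A point
outside `L` is close to some point of `L`, so twin-freeness keeps it from reaching the diameter. The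
four-point condition with `a` and `b` then makes any two outside points close. -/
theorem card_maxSpreads_odd (hd : IsTreeMetric d) (hS : HasDiam d S (2 * s + 1))
    (htf : TwinFree d S s (2 * s + 1)) (hL : IsMaxSpread (Far d s) S L) {a b : V} (ha : a ∈ L)
    (hb : b ∈ L) (hab : d a b = 2 * s + 1) :
    (maxSpreads (Far d s) S).card = S.card - L.card + 1 := by
  have haS := hL.subset ha
  have hbS := hL.subset hb
  have reach : ∀ l ∈ L, Reaches d S (2 * s + 1) l := by
    intro l hl
    have hlS := hL.subset hl
    by_cases hla : l = a
    · exact ⟨hlS, b, hbS, hla ▸ hab⟩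
    by_cases hlb : l = b
    · exact ⟨hlS, a, haS, by rw [hd.symm, hlb, hab]⟩
    have h1 := hL.spread l hl a ha hla
    have h2 := hL.spread l hl b hb hlb
    unfold Far at h1 h2
    have h3 := hS.le l hlS a haS
    have h4 := hS.le l hlS b hbS
    obtain ⟨m, hm⟩ := hd.even l a b
    refine ⟨hlS, ?_⟩
    rcases Nat.lt_or_ge (d l a) (2 * s + 1) with h | h
    · exact ⟨b, hbS, by omega⟩
    · exact ⟨a, haS, by omega⟩
  have notReach : ∀ u ∈ S, u ∉ L → ¬ Reaches d S (2 * s + 1) u := by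
    intro u hu huL h
    obtain ⟨l, hl, hul⟩ := hL.exists_not_far u hu huL
    unfold Far at hul
    have := htf u l h (reach l hl) (by omega)
    exact huL (this ▸ hl)
  refine card_maxSpreads_of_split hd.far_symm hL fun u hu huL w hw hwL h => ?_
  unfold Far at h
  have h1 := hd.fourPoint u w a b
  have hn1 : d u a ≠ 2 * s + 1 := fun h => notReach u hu huL ⟨hu, a, haS, h⟩
  have hn2 : d u b ≠ 2 * s + 1 := fun h => notReach u hu huL ⟨hu, b, hbS, h⟩
  have hn3 : d w a ≠ 2 * s + 1 := fun h => notReach w hw hwL ⟨hw, a, haS, h⟩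
  have hn4 : d w b ≠ 2 * s + 1 := fun h => notReach w hw hwL ⟨hw, b, hbS, h⟩
  have := hS.le u hu a haS
  have := hS.le u hu b hbS
  have := hS.le w hw a haS
  have := hS.le w hw b hbS
  omega

theorem exists_isMaxSpread_pair [DecidableEq V] (hd : IsTreeMetric d) {v w : V} (hv : v ∈ S)
    (hw : w ∈ S) (h : 2 * s ≤ d v w) : ∃ I, IsMaxSpread (Far d s) S I ∧ v ∈ I ∧ w ∈ I := by
  obtain ⟨I, h1, h2⟩ := Spread.exists_isMaxSpread_superset (far := Far d s) (S := S)
    (J := {v, w}) hd.far_symm (by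
      intro x hx y hy hxy
      simp only [mem_insert, mem_singleton] at hx hy
      rcases hx with rfl | rfl <;> rcases hy with rfl | rfl
      · exact absurd rfl hxy
      · exact h
      · exact hd.far_symm _ _ h
      · exact absurd rfl hxy) (by simp [insert_subset_iff, hv, hw])
  exact ⟨I, h2, h1 (by simp), h1 (by simp)⟩

theorem exists_isMaxSpread_mem [DecidableEq V] (hd : IsTreeMetric d) {v : V} (hv : v ∈ S) :
    ∃ I, IsMaxSpread (Far d s) S I ∧ v ∈ I := by
  obtain ⟨I, h1, h2⟩ := Spread.exists_isMaxSpread_superset (far := Far d s) (S := S)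
    (J := {v}) hd.far_symm (by
      intro x hx y hy hxy
      simp only [mem_singleton] at hx hy
      exact absurd (hx.trans hy.symm) hxy) (by simp [hv])
  exact ⟨I, h2, h1 (by simp)⟩

theorem spread_triple [DecidableEq V] (hd : IsTreeMetric d) {v w y : V} (h : 2 * s ≤ d v w)
    (hy : 2 * s ≤ d v y) (hy' : 2 * s ≤ d w y) : Spread (Far d s) {v, w, y} := by
  intro a ha b hb hab
  simp only [mem_insert, mem_singleton] at ha hb
  have := hd.symm v w
  have := hd.symm v y
  have := hd.symm w y
  unfold Far
  rcases ha with rfl | rfl | rfl <;> rcases hb with rfl | rfl | rfl <;>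
    first | exact absurd rfl hab | omega

/-- If `v` has a twin `v'`, two maximal spread sets through `v` are lost when `v` is removed. -/
theorem card_erase_twin [DecidableEq V] (hd : IsTreeMetric d) (hs : 1 ≤ s) (hS : HasDiam d S D)
    (hD : 2 * s ≤ D) {v v' : V} (hv : Reaches d S D v) (hv' : Reaches d S D v') (hne : v ≠ v')
    (hvv : d v v' < 2 * s) {I₁ I₂ : Finset V} (h₁ : IsMaxSpread (Far d s) S I₁)
    (h₂ : IsMaxSpread (Far d s) S I₂) (hv₁ : v ∈ I₁) (hv₂ : v ∈ I₂) (hI : I₁ ≠ I₂) :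
    (maxSpreads (Far d s) (S.erase v)).card + 2 ≤ (maxSpreads (Far d s) S).card := by
  obtain ⟨hvS, w, hw, hvw⟩ := hv
  obtain ⟨hvS', w', hw', hvw'⟩ := hv'
  rw [← card_pair hI]
  refine card_maxSpreads_add_card_le hd.far_symm (hd.not_far_self hs) (erase_subset _ _) _ ?_ ?_
  · simp only [mem_insert, mem_singleton]
    rintro I (rfl | rfl) <;> assumption
  · intro I hI
    have hI' : IsMaxSpread (Far d s) S I ∧ v ∈ I := by
      simp only [mem_insert, mem_singleton] at hI
      rcases hI with rfl | rfl
      · exact ⟨h₁, hv₁⟩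
      · exact ⟨h₂, hv₂⟩
    -- Whatever is far from `v` is far from its twin, so `v'` can replace the deleted `v`.
    refine ⟨v', mem_erase.2 ⟨hne.symm, hvS'⟩, fun y hy hyS => ?_⟩
    rw [mem_erase] at hyS
    exact hd.far_symm _ _ ((hd.far_of_twin hD hS.le hvS hvS' hw hw' hvw hvw' hvv).2 y hyS.2
      (hI'.1.spread y hy v hI'.2 hyS.1))

/-- Maximal spread sets through `v` without points at distance exactly `2 * s` from `v` are lost
when `v` is removed. -/
theorem card_erase_end [DecidableEq V] (hd : IsTreeMetric d) (hs : 1 ≤ s) {v x : V} (hx : x ∈ S)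
    (hvx : d v x = 1) (F : Finset (Finset V))
    (hF : ∀ I ∈ F, IsMaxSpread (Far d s) S I ∧ v ∈ I ∧ ∀ y ∈ I, d v y ≠ 2 * s) :
    (maxSpreads (Far d s) (S.erase v)).card + F.card ≤ (maxSpreads (Far d s) S).card := by
  -- The other points of such a set are at distance at least `2 * s + 1` from `v`, hence still far
  -- from its neighbour `x`, which can be added after `v` is deleted.
  refine card_maxSpreads_add_card_le hd.far_symm (hd.not_far_self hs) (erase_subset _ _) _
    (fun I hI => (hF I hI).1) fun I hI => ⟨x, mem_erase.2 ⟨?_, hx⟩, fun y hy hyS => ?_⟩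
  · rintro rfl
    rw [hd.self] at hvx
    omega
  · obtain ⟨h1, h2, h3⟩ := hF I hI
    rw [mem_erase] at hyS
    have h4 := h1.spread v h2 y hy hyS.1.symm
    have h5 := h3 y hy
    unfold Far at *
    have := hd.tri v x y
    omega

theorem HasDiam.erase_of_pair [DecidableEq V] (hS : HasDiam d S D) {v a b : V} (ha : a ∈ S)
    (hb : b ∈ S) (hav : a ≠ v) (hbv : b ≠ v) (hab : d a b = D) : HasDiam d (S.erase v) D :=
  ⟨fun x hx y hy => hS.le x (mem_of_mem_erase hx) y (mem_of_mem_erase hy),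
    a, mem_erase.2 ⟨hav, ha⟩, b, mem_erase.2 ⟨hbv, hb⟩, hab⟩

/-- The case of a branch point `c` at distance `s` from two ends: removing the branch at `c`
that contains one of the ends. -/
theorem exists_branch [DecidableEq V] (hd : IsTreeMetric d) (hs : 1 ≤ s) (hSg : IsGeodesic d S)
    (hS : HasDiam d S D) (hD : 2 * s + 1 ≤ D) (htf : TwinFree d S s D) {v v' w : V} (hv : v ∈ S)
    (hv' : v' ∈ S) (hw : w ∈ S) (hvw : d v w = D) (hvw' : d v' w = D) (hvv : d v v' = 2 * s) :
    ∃ S' ⊆ S, IsGeodesic d S' ∧ HasDiam d S' D ∧ S'.card < S.card ∧ s ≤ S.card - S'.card ∧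
      (maxSpreads (Far d s) S').card + (S.card - S'.card - 1) ≤
        (maxSpreads (Far d s) S).card := by
  obtain ⟨c, hc, hvc, hcw⟩ := hSg v hv w hw s (by omega)
  have hcv := hd.symm v c
  have hcv' : d c v' = s := by
    have h1 := hd.dist_between (x := v) (y := w) (m := c) (by omega) v'
    have := hd.symm v' c
    have := hd.symm v' v
    omega
  -- The branch at `c` containing `v`: equality `d u v = d u c + s` would mean that `c` lies between
  -- `u` and `v`.
  let A := S.filter (fun u => d u v < d u c + s)
  have hA : ∀ u, u ∈ A ↔ u ∈ S ∧ d u v < d u c + s := fun u => mem_filter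
  have hAS : A ⊆ S := filter_subset _ _
  have memS' : ∀ u, u ∈ S \ A ↔ u ∈ S ∧ d u v = d u c + s := by
    intro u
    rw [mem_sdiff, hA]
    have := hd.tri u c v
    constructor
    · rintro ⟨h1, h2⟩
      exact ⟨h1, by_contra fun h3 => h2 ⟨h1, by omega⟩⟩
    · rintro ⟨h1, h2⟩
      exact ⟨h1, fun h3 => by omega⟩
  have hvA : v ∈ A := (hA v).2 ⟨hv, by rw [hd.self]; omega⟩
  have hcard : (S \ A).card = S.card - A.card := card_sdiff_of_subset hAS
  have hAle : A.card ≤ S.card := card_le_card hAS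
  have hApos : 0 < A.card := card_pos.2 ⟨v, hvA⟩
  have hsA : s ≤ A.card := by
    refine (hSg.card_ball hd hv hw (by omega)).trans (card_le_card fun u hu => ?_)
    rw [mem_filter] at hu
    exact (hA u).2 ⟨hu.1, by omega⟩
  have hwS' : w ∈ S \ A := (memS' w).2 ⟨hw, by
    have := hd.symm w v
    have := hd.symm w c
    omega⟩
  have hvS' : v' ∈ S \ A := (memS' v').2 ⟨hv', by
    have := hd.symm v' v
    have := hd.symm v' c
    omega⟩
  -- Every point of the branch is separated from `w` by `c`, so its depth is at most `s`. A point of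
  -- depth `s` reaches `D` and is close to `v`, hence is `v` by twin-freeness. Parity improves `d u
  -- v < d u c + s` by one.
  have hdepth : ∀ u ∈ A, 1 ≤ d u c ∧ d u c ≤ s ∧ d u v + 2 ≤ d u c + s ∧
      (d u c = s → u = v) := by
    intro u hu
    obtain ⟨huS, hu⟩ := (hA u).1 hu
    have h1 := hd.fourPoint u c v w
    have h2 := hS.le u huS w hw
    have h3 : d u c + D ≤ d u w + s := by omega
    obtain ⟨m, hm⟩ := hd.even u v c
    refine ⟨?_, by omega, by omega, fun h => ?_⟩
    · by_contra h0
      have := hd.eq_of_zero u c (by omega)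
      subst this
      omega
    · exact htf u v ⟨huS, w, hw, by omega⟩ ⟨hv, w, hw, hvw⟩ (by omega)
  -- Pairwise closeness inside the branch makes maximal sets through different points of it
  -- different.
  have hAA : ∀ u ∈ A, ∀ u' ∈ A, d u u' < 2 * s := by
    intro u hu u' hu'
    have h1 := hdepth u hu
    have h2 := hdepth u' hu'
    have h3 := hd.fourPoint u u' c v
    have h4 := hd.symm c v
    omega
  refine ⟨S \ A, sdiff_subset, ?_, ?_, by omega, by omega, ?_⟩
  · intro x hx y hy i hi
    obtain ⟨hxS, hx⟩ := (memS' x).1 hx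
    obtain ⟨hyS, hy⟩ := (memS' y).1 hy
    obtain ⟨z, hz, h1, h2⟩ := hSg x hxS y hyS i hi
    refine ⟨z, (memS' z).2 ⟨hz, ?_⟩, h1, h2⟩
    have h3 := hd.dist_between (x := x) (y := y) (m := z) (by omega) c
    have h4 := hd.dist_between (x := x) (y := y) (m := z) (by omega) v
    have := hd.symm c x
    have := hd.symm c y
    have := hd.symm c z
    have := hd.symm v x
    have := hd.symm v y
    have := hd.symm v z
    omega
  · exact ⟨fun x hx y hy => hS.le x (mem_sdiff.1 hx).1 y (mem_sdiff.1 hy).1, v', hvS', w, hwS',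
      hvw'⟩
  · have key : ∀ u, ∃ I, u ∈ A → IsMaxSpread (Far d s) S I ∧ u ∈ I := by
      intro u
      by_cases hu : u ∈ A
      · obtain ⟨I, h⟩ := exists_isMaxSpread_mem (s := s) hd (hAS hu)
        exact ⟨I, fun _ => h⟩
      · exact ⟨∅, fun h => absurd h hu⟩
    choose e he using key
    have hinj : Set.InjOn e (A.erase v : Finset V) := by
      intro u hu u' hu' h
      have hu := mem_of_mem_erase (mem_coe.1 hu)
      have hu' := mem_of_mem_erase (mem_coe.1 hu')
      by_contra hne
      have h1 := (he u hu).1.spread u (he u hu).2 u' (h ▸ (he u' hu').2) hne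
      have h2 := hAA u hu u' hu'
      unfold Far at h1
      omega
    have h1 : S.card - (S \ A).card - 1 = ((A.erase v).image e).card := by
      rw [card_image_of_injOn hinj, card_erase_of_mem hvA]
      omega
    rw [h1]
    refine card_maxSpreads_add_card_le hd.far_symm (hd.not_far_self hs) sdiff_subset _ ?_ ?_
    · intro I hI
      obtain ⟨u, hu, rfl⟩ := mem_image.1 hI
      exact (he u (mem_of_mem_erase hu)).1
    · intro I hI
      obtain ⟨u, hu, rfl⟩ := mem_image.1 hI
      rw [mem_erase] at hu
      obtain ⟨hI, huI⟩ := he u hu.2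
      obtain ⟨h1, h2, h3, h4⟩ := hdepth u hu.2
      have h5 : d u c ≠ s := fun h => hu.1 (h4 h)
      -- The point towards `v'` of the same depth as `u` can be added to the trace. A point `y` of
      -- the set outside the branch has depth at least `2 * s - d u c > s`, too deep to share a
      -- branch at `c` with `v'`, so it is as far from `z` as required.
      obtain ⟨z, hz, hcz, hzv'⟩ := hSg c hc v' hv' (d u c) (by omega)
      have h6 := hd.dist_between (x := c) (y := v') (m := z) (by omega) v
      have h7 := hd.dist_between (x := c) (y := v') (m := z) (by omega) w
      have e1 := hd.symm v z
      have e2 := hd.symm z c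
      have e3 := hd.symm w c
      have e4 := hd.symm w v'
      have e5 := hd.symm w z
      refine ⟨z, (memS' z).2 ⟨hz, by omega⟩, fun y hyI hy => ?_⟩
      obtain ⟨hyS, hyv⟩ := (memS' y).1 hy
      have h8 := hI.spread u huI y hyI (by
        rintro rfl
        exact absurd (((hA u).1 hu.2).2) (by omega))
      unfold Far at *
      have h9 := hd.tri u c y
      have h10 := hd.fourPoint z w y c
      have h11 := hS.le y hyS w hw
      have h12 := hd.fourPoint y c z w
      have e6 := hd.symm y c
      have e7 := hd.symm y z
      have e8 := hd.symm c y
      omega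

end Bound

/-! ### The lower bound by induction on subtrees -/

section Main

variable {V : Type*} {d : V → V → ℕ} {S L : Finset V} {s D : ℕ}

/-- The cases in which the lower bound is not attained. -/
def IsStrict {V : Type*} (d : V → V → ℕ) (S : Finset V) (s D : ℕ) : Prop :=
  2 * s + 2 ≤ D ∨ (D = 2 * s + 1 ∧ ¬ TwinFree d S s D) ∨ (D = 2 * s ∧ ¬ SpecialFree d S s D)

/-- The lower bound holds for `S`, strictly in the cases `IsStrict`. -/
def BoundHolds {V : Type*} (d : V → V → ℕ) (S : Finset V) (s D : ℕ) : Prop :=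
  lowerBound s S.card ≤ (maxSpreads (Far d s) S).card ∧
    (IsStrict d S s D → lowerBound s S.card < (maxSpreads (Far d s) S).card)

theorem boundHolds_of_lt (h : lowerBound s S.card < (maxSpreads (Far d s) S).card) :
    BoundHolds d S s D := ⟨h.le, fun _ => h⟩

theorem HasDiam.unique {D' : ℕ} (h : HasDiam d S D) (h' : HasDiam d S D') : D = D' := by
  obtain ⟨x, hx, y, hy, e⟩ := h.exists_eq
  obtain ⟨x', hx', y', hy', e'⟩ := h'.exists_eq
  have := h.le x' hx' y' hy'
  have := h'.le x hx y hy
  omega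

theorem exists_hasDiam (hS : S.Nonempty) : ∃ D, HasDiam d S D := by
  obtain ⟨x, hx⟩ := hS
  obtain ⟨p, hp, hmax⟩ := (S ×ˢ S).exists_max_image (fun p => d p.1 p.2) ⟨(x, x), by simp [hx]⟩
  rw [mem_product] at hp
  exact ⟨d p.1 p.2, fun a ha b hb => hmax (a, b) (mem_product.2 ⟨ha, hb⟩), p.1, hp.1, p.2, hp.2,
    rfl⟩

/-- Given two far pairs of twins `v, v'` and `u, u'`, there are maximal sets through `v, u` and
through `v, u'`. They differ because `u` and `u'` are close, and both are lost with `v`, one more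
than the bound allows for. -/
theorem bound_of_diam_eq_two_mul [DecidableEq V] (hd : IsTreeMetric d) (hs : 1 ≤ s)
    (hSg : IsGeodesic d S) (hS : HasDiam d S (2 * s))
    (ih : ∀ S' ⊂ S, IsGeodesic d S' → ∀ D, HasDiam d S' D → 2 * s ≤ D → BoundHolds d S' s D) :
    BoundHolds d S s (2 * s) := by
  by_cases hsp : SpecialFree d S s (2 * s)
  · refine ⟨?_, fun h => ?_⟩
    · obtain ⟨a, ha, b, hb, hab⟩ := hS.exists_eq
      obtain ⟨L, hL, haL, hbL⟩ := exists_isMaxSpread_pair hd ha hb hab.ge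
      have hL2 : 2 ≤ L.card := one_lt_card.2 ⟨a, haL, b, hbL, hd.ne (by omega)⟩
      rw [card_maxSpreads_even hd hS hsp hL hL2]
      exact lowerBound_le_of_mul_lt _ _ _ hs (packing hd hSg hL.subset hL.spread hL2)
    · rcases h with h | h | h
      · omega
      · omega
      · exact absurd hsp h.2
  · refine boundHolds_of_lt ?_
    unfold SpecialFree at hsp
    push Not at hsp
    obtain ⟨v, v', u, u', hv, hv', hu, hu', hvv, huu, dvv, duu, duv⟩ := hsp
    obtain ⟨hvS, w, hw, hvw⟩ := hv
    obtain ⟨huS, x, hx, hux⟩ := hu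
    obtain ⟨huS', x', hx', hux'⟩ := hu'
    have h1 := (hd.far_of_twin le_rfl hS.le huS huS' hx hx' hux hux' duu).2 v hvS
      (by rwa [hd.symm])
    obtain ⟨I₁, hI₁, hv₁, hu₁⟩ := exists_isMaxSpread_pair (s := s) hd hvS huS (by rwa [hd.symm])
    obtain ⟨I₂, hI₂, hv₂, hu₂⟩ := exists_isMaxSpread_pair (s := s) hd hvS huS' h1
    have hne : I₁ ≠ I₂ := by
      rintro rfl
      have := hI₁.spread u hu₁ u' hu₂ huu
      unfold Far at this
      omega
    have h2 := card_erase_twin hd hs hS le_rfl ⟨hvS, w, hw, hvw⟩ hv' hvv dvv hI₁ hI₂ hv₁ hv₂ hne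
    obtain ⟨hvS', w', hw', hvw'⟩ := hv'
    have hw'v : w' ≠ v := by
      rintro rfl
      have := hd.symm v' w'
      omega
    have h3 := ih _ (erase_ssubset hvS) (hSg.erase hd hvS hw (by rw [hvw]; exact hS.le)) _
      (hS.erase_of_pair hvS' hw' hvv.symm hw'v hvw') le_rfl
    have h4 := h3.1
    rw [card_erase_of_mem hvS] at h4
    have h5 := lowerBound_le_succ s S.card (card_pos.2 ⟨v, hvS⟩)
    omega

theorem bound_of_twin [DecidableEq V] (hd : IsTreeMetric d) (hs : 1 ≤ s)
    (hSg : IsGeodesic d S) (hS : HasDiam d S D) (hD : 2 * s + 1 ≤ D)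
    (ih : ∀ S' ⊂ S, IsGeodesic d S' → ∀ D, HasDiam d S' D → 2 * s ≤ D → BoundHolds d S' s D)
    (htf : ¬ TwinFree d S s D) : lowerBound s S.card < (maxSpreads (Far d s) S).card := by
  unfold TwinFree at htf
  push Not at htf
  obtain ⟨v, v', hv, hv', dvv, hvv⟩ := htf
  have hv0 := hv
  have hv0' := hv'
  obtain ⟨hvS, w, hw, hvw⟩ := hv
  -- Two consecutive points of the geodesic, both far from `v` but close to each other, give two
  -- different maximal sets through `v`.
  obtain ⟨w₁, hw₁, h₁, h₁'⟩ := hSg v hvS w hw (2 * s + 1) (by omega)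
  obtain ⟨w₂, hw₂, h₂, h₂'⟩ := hSg v hvS w hw (2 * s) (by omega)
  obtain ⟨I₁, hI₁, hv₁, hu₁⟩ := exists_isMaxSpread_pair (s := s) hd hvS hw₁ (by omega)
  obtain ⟨I₂, hI₂, hv₂, hu₂⟩ := exists_isMaxSpread_pair (s := s) hd hvS hw₂ (by omega)
  have hne : I₁ ≠ I₂ := by
    rintro rfl
    have h3 := hI₁.spread w₁ hu₁ w₂ hu₂ (by rintro rfl; omega)
    unfold Far at h3
    have h4 := hd.dist_between (x := v) (y := w) (m := w₂) (by omega) w₁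
    have := hd.symm w₁ v
    omega
  have h2 := card_erase_twin hd hs hS (by omega) hv0 hv0' hvv dvv hI₁ hI₂ hv₁ hv₂ hne
  obtain ⟨hvS', w', hw', hvw'⟩ := hv'
  have hw'v : w' ≠ v := by
    rintro rfl
    have := hd.symm v' w'
    omega
  have h3 := ih _ (erase_ssubset hvS) (hSg.erase hd hvS hw (by rw [hvw]; exact hS.le)) _
    (hS.erase_of_pair hvS' hw' hvv.symm hw'v hvw') (by omega)
  have h4 := h3.1
  rw [card_erase_of_mem hvS] at h4
  have h5 := lowerBound_le_succ s S.card (card_pos.2 ⟨v, hvS⟩)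
  omega

theorem bound_of_odd [DecidableEq V] (hd : IsTreeMetric d) (hs : 1 ≤ s)
    (hSg : IsGeodesic d S) (hS : HasDiam d S (2 * s + 1))
    (ih : ∀ S' ⊂ S, IsGeodesic d S' → ∀ D, HasDiam d S' D → 2 * s ≤ D → BoundHolds d S' s D) :
    BoundHolds d S s (2 * s + 1) := by
  by_cases htf : TwinFree d S s (2 * s + 1)
  · refine ⟨?_, fun h => ?_⟩
    · obtain ⟨a, ha, b, hb, hab⟩ := hS.exists_eq
      obtain ⟨L, hL, haL, hbL⟩ := exists_isMaxSpread_pair (s := s) hd ha hb (by omega)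
      rw [card_maxSpreads_odd hd hS htf hL haL hbL hab]
      have := packing_odd hd hSg hL.subset hL.spread haL hbL hab
      exact lowerBound_le_of_mul_lt _ _ _ hs (by omega)
    · rcases h with h | h | h
      · omega
      · exact absurd htf h.2
      · omega
  · exact boundHolds_of_lt (bound_of_twin hd hs hSg hS le_rfl ih htf)

/-- Diameter `2 * s + 2`, with `v` the end of every diametral path. -/
theorem bound_of_unique_end [DecidableEq V] (hd : IsTreeMetric d) (hs : 1 ≤ s)
    (hSg : IsGeodesic d S) (hS : HasDiam d S (2 * s + 2)) {v w x : V} (hv : v ∈ S)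
    (hw : w ∈ S) (hx : x ∈ S) (hvw : d v w = 2 * s + 2) (hvx : d v x = 1)
    (hxw : d x w = 2 * s + 1)
    (hS' : HasDiam d (S.erase v) (2 * s + 1))
    (hbr : ∀ y ∈ S, d y w = 2 * s + 2 → d v y ≠ 2 * s)
    (hbr' : ∀ y ∈ S, d y v = 2 * s + 2 → d w y ≠ 2 * s)
    (ih : BoundHolds d (S.erase v) s (2 * s + 1)) :
    lowerBound s S.card < (maxSpreads (Far d s) S).card := by
  have hcard := card_erase_of_mem hv
  have hpos : 0 < S.card := card_pos.2 ⟨v, hv⟩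
  have hlb := lowerBound_le_succ s S.card hpos
  obtain ⟨w₁, hw₁, hvw₁, hw₁w⟩ := hSg v hv w hw (2 * s + 1) (by omega)
  have hxv : x ≠ v := (hd.ne (by omega)).symm
  have hwv : w ≠ v := (hd.ne (by omega)).symm
  have sS' : ∀ y, y ∈ S.erase v ↔ y ≠ v ∧ y ∈ S := fun y => mem_erase
  -- parity of the distances to the two ends
  have par : ∀ y, ∃ m, d v y + d w y = 2 * m := by
    intro y
    obtain ⟨m, hm⟩ := hd.even v w y
    exact ⟨m - (s + 1), by omega⟩
  -- points at distance `2 * s + 1` from `v` and close to `w`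
  have single : ∀ z ∈ S, d v z = 2 * s + 1 → d z w < 2 * s → ∀ I, IsMaxSpread (Far d s) S I →
      v ∈ I → z ∈ I → ∀ y ∈ I, d v y ≠ 2 * s := by
    intro z hz hvz hzw I hI hvI hzI y hy hvy
    have h1 := hI.spread z hzI y hy (by rintro rfl; omega)
    unfold Far at h1
    have h2 := hd.fourPoint z y v w
    have h3 := hS.le y (hI.subset hy) w hw
    have h4 := hbr y (hI.subset hy)
    obtain ⟨m, hm⟩ := par y
    have := hd.symm z v
    have := hd.symm y v
    have := hd.symm y w
    omega
  have two : ∀ I₁ I₂ : Finset V, I₁ ≠ I₂ → IsMaxSpread (Far d s) S I₁ → IsMaxSpread (Far d s) S I₂ →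
      v ∈ I₁ → v ∈ I₂ → (∀ y ∈ I₁, d v y ≠ 2 * s) → (∀ y ∈ I₂, d v y ≠ 2 * s) →
      lowerBound s S.card < (maxSpreads (Far d s) S).card := by
    intro I₁ I₂ hne h1 h2 hv1 hv2 h3 h4
    have := card_erase_end hd hs hx hvx {I₁, I₂} (by
      intro I hI
      rw [mem_insert, mem_singleton] at hI
      rcases hI with rfl | rfl
      · exact ⟨h1, hv1, h3⟩
      · exact ⟨h2, hv2, h4⟩)
    rw [card_pair hne] at this
    have := ih.1
    rw [hcard] at this
    omega
  obtain ⟨I₁, hI₁, hvI₁, hwI₁⟩ := exists_isMaxSpread_pair (s := s) hd hv hw₁ (by omega)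
  have hI₁' := single w₁ hw₁ hvw₁ (by omega) I₁ hI₁ hvI₁ hwI₁
  have hnw : w ∉ I₁ := by
    intro h
    have := hI₁.spread w₁ hwI₁ w h (by rintro rfl; omega)
    unfold Far at this
    omega
  have one := card_erase_end hd hs hx hvx {I₁} (by simpa using ⟨hI₁, hvI₁, hI₁'⟩)
  rw [card_singleton] at one
  -- With such a `y'`, a maximal set through `v, w, y'` is a second lost set.
  by_cases hα : ∃ y ∈ S, d v y = 2 * s + 1 ∧ d w y = 2 * s + 1
  · obtain ⟨y', hy', hvy', hwy'⟩ := hα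
    obtain ⟨I, h1, hI⟩ := Spread.exists_isMaxSpread_superset hd.far_symm
      (spread_triple (s := s) hd (v := v) (w := w) (y := y') (by omega) (by omega) (by omega))
      (S := S) (by simp [insert_subset_iff, hv, hw, hy'])
    have hvI : v ∈ I := h1 (by simp)
    have hwI : w ∈ I := h1 (by simp)
    have hyI : y' ∈ I := h1 (by simp)
    refine two I₁ I (by rintro rfl; exact hnw hwI) hI₁ hI hvI₁ hvI hI₁' fun y hy hvy => ?_
    have h2 := hI.spread y' hyI y hy (by rintro rfl; omega)
    have h3 := hI.spread w hwI y hy (by rintro rfl; omega)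
    unfold Far at h2 h3
    have h4 := hbr y (hI.subset hy)
    have h5 := hS.le y (hI.subset hy) w hw
    obtain ⟨m, hm⟩ := par y
    obtain ⟨m', hm'⟩ := hd.even v y' y
    have h6 := hd.fourPoint y' y v w
    have := hd.symm y v
    have := hd.symm y w
    have := hd.symm y' v
    have := hd.symm y' w
    omega
  · by_cases hβ : ∃ y ∈ S, d v y = 2 * s ∧ d w y = 2 * s
    -- Here `v, w, y'` are pairwise far, so packing with three balls lowers the bound to at most
    -- `|S| - 2`. Without `v` there are already `|S| - 2` maximal sets if twin-free, since `L = {x,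
    -- w}`; otherwise the induction hypothesis is strict.
    · obtain ⟨y', hy', hvy', hwy'⟩ := hβ
      have hpack := packing (s := s) (S := S) (L := {v, w, y'}) hd hSg
        (by simp [insert_subset_iff, hv, hw, hy'])
        (spread_triple (s := s) hd (by omega) (by omega) (by omega))
      have hc3 : ({v, w, y'} : Finset V).card = 3 := by
        rw [card_eq_three]
        exact ⟨v, w, y', hd.ne (by omega), hd.ne (by omega), hd.ne (by omega), rfl⟩
      rw [hc3] at hpack
      have hpack := hpack (by omega)
      have hlow := lowerBound_le_of_mul_lt s S.card 3 hs hpack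
      by_cases htf : TwinFree d (S.erase v) s (2 * s + 1)
      · obtain ⟨L, hL, hxL, hwL⟩ := exists_isMaxSpread_pair (s := s) hd ((sS' x).2 ⟨hxv, hx⟩)
          ((sS' w).2 ⟨hwv, hw⟩) (by omega)
        have h1 := card_maxSpreads_odd hd hS' htf hL hxL hwL hxw
        -- By parity, a third point is at distance `2 * s` from one of `x, w` and `2 * s + 1` from
        -- the other. Then it is at distance `2 * s + 1` from both `v` and `w`, against `hα`, or it
        -- contradicts `hbr'`.
        have hLe : L ⊆ {x, w} := by
          intro l hl
          by_contra hlx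
          simp only [mem_insert, mem_singleton, not_or] at hlx
          have hlS := hL.subset hl
          have h2 := hL.spread l hl x hxL hlx.1
          have h3 := hL.spread l hl w hwL hlx.2
          unfold Far at h2 h3
          have h4 := hS'.le l hlS x ((sS' x).2 ⟨hxv, hx⟩)
          have h5 := hS'.le l hlS w ((sS' w).2 ⟨hwv, hw⟩)
          rw [sS'] at hlS
          have e1 := hd.symm l w
          have e2 := hd.symm l v
          have e3 := hd.symm l x
          have e4 := hd.symm v x
          obtain ⟨m, hm⟩ := par l
          obtain ⟨m', hm'⟩ := hd.even v x l
          have h6 := hd.fourPoint x w v l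
          have h7 := hd.tri v x l
          have h8 := hd.dist_between (x := v) (y := w) (m := x) (by omega) l
          have h9 := hbr' l hlS.2
          have h10 := hS.le v hv l hlS.2
          exact hα ⟨l, hlS.2, by omega, by omega⟩
        have hL2 : L.card ≤ 2 := (card_le_card hLe).trans card_le_two
        have hL2' : 2 ≤ L.card := one_lt_card.2 ⟨x, hxL, w, hwL, hd.ne (by omega)⟩
        rw [hcard] at h1
        omega
      · have h1 := ih.2 (Or.inr (Or.inl ⟨rfl, htf⟩))
        rw [hcard] at h1
        omega
    · obtain ⟨I, hI, hvI, hwI⟩ := exists_isMaxSpread_pair (s := s) hd hv hw (by omega)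
      refine two I₁ I (by rintro rfl; exact hnw hwI) hI₁ hI hvI₁ hvI hI₁' fun y hy hvy => ?_
      have h3 := hI.spread w hwI y hy (by rintro rfl; omega)
      unfold Far at h3
      have h4 := hbr y (hI.subset hy)
      have h5 := hS.le y (hI.subset hy) w hw
      have := hd.symm y w
      obtain ⟨m, hm⟩ := par y
      exact hβ ⟨y, hI.subset hy, hvy, by omega⟩

/-- After twins are handled, two ends at distance exactly `2 * s` with a common opposite end allow a
branch to be removed while keeping the diameter. Otherwise deleting `v` loses at least one maximal
set, which suffices when the rest is still strict. The only remaining case is a drop of the diameter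
from `2 * s + 2` to `2 * s + 1`. -/
theorem bound_of_large_diam [DecidableEq V] (hd : IsTreeMetric d) (hs : 1 ≤ s)
    (hSg : IsGeodesic d S) (hS : HasDiam d S D) (hD : 2 * s + 2 ≤ D)
    (ih : ∀ S' ⊂ S, IsGeodesic d S' → ∀ D, HasDiam d S' D → 2 * s ≤ D → BoundHolds d S' s D) :
    lowerBound s S.card < (maxSpreads (Far d s) S).card := by
  by_cases htf : TwinFree d S s D
  swap
  · exact bound_of_twin hd hs hSg hS (by omega) ih htf
  by_cases hbr : ∃ v ∈ S, ∃ v' ∈ S, ∃ w ∈ S, d v w = D ∧ d v' w = D ∧ d v v' = 2 * s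
  · obtain ⟨v, hv, v', hv', w, hw, h1, h2, h3⟩ := hbr
    obtain ⟨S', hS'S, hg, hdiam, hlt, hsb, hcard⟩ := exists_branch hd hs hSg hS (by omega) htf
      hv hv' hw h1 h2 h3
    have h4 := (ih S' (hS'S.ssubset_of_ne (by rintro rfl; omega)) hg D hdiam (by omega)).2 (Or.inl hD)
    obtain ⟨a, ha, -⟩ := hdiam.exists_eq
    have h5 : 0 < S'.card := card_pos.2 ⟨a, ha⟩
    have h6 := lowerBound_add_one_le s S.card (S.card - S'.card) hs hsb (by omega)
    rw [show S.card - (S.card - S'.card) = S'.card by omega] at h6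
    omega
  · push Not at hbr
    obtain ⟨v, hv, w, hw, hvw⟩ := hS.exists_eq
    have hcard := card_erase_of_mem hv
    have hpos : 0 < S.card := card_pos.2 ⟨v, hv⟩
    have hlb := lowerBound_le_succ s S.card hpos
    obtain ⟨x, hx, hvx, hxw⟩ := hSg v hv w hw 1 (by omega)
    have hxv : x ≠ v := (hd.ne (by omega)).symm
    have hwv : w ≠ v := (hd.ne (by omega)).symm
    have hxS' : x ∈ S.erase v := mem_erase.2 ⟨hxv, hx⟩
    have hwS' : w ∈ S.erase v := mem_erase.2 ⟨hwv, hw⟩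
    have hg : IsGeodesic d (S.erase v) := hSg.erase hd hv hw (by rw [hvw]; exact hS.le)
    obtain ⟨D', hD'⟩ := exists_hasDiam (d := d) ⟨x, hxS'⟩
    have hDD' := hD'.le x hxS' w hwS'
    have hih := ih _ (erase_ssubset hv) hg D' hD' (by omega)
    rcases Nat.lt_or_ge D' (2 * s + 2) with h | h
    · have h1 : D' = 2 * s + 1 := by omega
      have h2 : D = 2 * s + 2 := by omega
      subst h1 h2
      refine bound_of_unique_end hd hs hSg hS hv hw hx hvw hvx (by omega) hD'
        (fun y hy h => hbr v hv y hy w hw hvw h) (fun y hy h => hbr w hw y hy v hv ?_ h) hih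
      rw [hd.symm, hvw]
    · have h1 := hih.2 (Or.inl h)
      rw [hcard] at h1
      obtain ⟨w₁, hw₁, hvw₁, hw₁w⟩ := hSg v hv w hw (2 * s + 1) (by omega)
      obtain ⟨I, hI, hvI, hwI⟩ := exists_isMaxSpread_pair (s := s) hd hv hw₁ (by omega)
      have one := card_erase_end hd hs hx hvx {I} (by
        simp only [mem_singleton, forall_eq]
        refine ⟨hI, hvI, fun y hy hvy => ?_⟩
        have h2 := hI.spread w₁ hwI y hy (by rintro rfl; omega)
        unfold Far at h2
        -- A point `y` of `I` with `d v y = 2 * s` would have `d y w ≥ D - 1`, hence `d y w = D` by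
        -- parity, which the absence of branches excludes.
        have h3 := hd.dist_between (x := v) (y := w) (m := w₁) (by omega) y
        have h4 := hS.le y (hI.subset hy) w hw
        have h5 := hbr v hv y (hI.subset hy) w hw hvw
        have := hd.symm y v
        have := hd.symm y w₁
        obtain ⟨m, hm⟩ := hd.even v y w
        omega)
      rw [card_singleton] at one
      omega

theorem boundHolds (hd : IsTreeMetric d) (hs : 1 ≤ s) (hSg : IsGeodesic d S)
    (hS : HasDiam d S D) (hD : 2 * s ≤ D) : BoundHolds d S s D := by
  classical
  induction S using Finset.strongInduction generalizing D with
  | H S ih =>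
    have ih' : ∀ S' ⊂ S, IsGeodesic d S' → ∀ D, HasDiam d S' D → 2 * s ≤ D →
        BoundHolds d S' s D := fun S' h h1 D h2 h3 => ih S' h h1 h2 h3
    rcases Nat.lt_or_ge D (2 * s + 2) with h | h
    · rcases Nat.lt_or_ge D (2 * s + 1) with h1 | h1
      · obtain rfl : D = 2 * s := by omega
        exact bound_of_diam_eq_two_mul hd hs hSg hS ih'
      · obtain rfl : D = 2 * s + 1 := by omega
        exact bound_of_odd hd hs hSg hS ih'
    · exact boundHolds_of_lt (bound_of_large_diam hd hs hSg hS h ih')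

/-- If all distances are small, the maximal spread sets are the singletons. -/
theorem card_maxSpreads_of_small (hd : IsTreeMetric d) (hne : S.Nonempty)
    (h : ∀ x ∈ S, ∀ y ∈ S, d x y < 2 * s) : (maxSpreads (Far d s) S).card = S.card := by
  classical
  obtain ⟨x, hx⟩ := hne
  obtain ⟨L, hL, hxL⟩ := exists_isMaxSpread_mem (s := s) hd hx
  have hLc : L.card = 1 := by
    rw [card_eq_one]
    refine ⟨x, Subset.antisymm (fun y hy => ?_) (by simpa using hxL)⟩
    by_contra hyx
    have h1 := hL.spread y hy x hxL (by simpa using hyx)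
    have h2 := h y (hL.subset hy) x hx
    unfold Far at h1
    omega
  rw [card_maxSpreads_of_split hd.far_symm hL fun a ha _ b hb _ => not_le.2 (h a ha b hb)]
  have : 0 < S.card := card_pos.2 ⟨x, hx⟩
  omega

end Main

/-! ### Graph distance of a tree as a tree metric -/

/-- Models the distance from a fixed vertex along a geodesic: it changes by one at each step and
never turns from rising to falling, so it is V-shaped. The bottom is the projection onto the
geodesic. -/
theorem exists_valley (f : ℕ → ℕ) (m : ℕ)
    (hstep : ∀ i < m, f (i + 1) = f i + 1 ∨ f i = f (i + 1) + 1)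
    (hup : ∀ i, i + 2 ≤ m → f (i + 1) = f i + 1 → f (i + 2) = f (i + 1) + 1) :
    ∃ i ≤ m, (∀ j ≤ i, f j = f i + (i - j)) ∧ ∀ j, i ≤ j → j ≤ m → f j = f i + (j - i) := by
  induction m with
  | zero => exact ⟨0, le_rfl, by simp, fun j _ h => by simp [Nat.le_zero.1 h]⟩
  | succ m ih =>
    obtain ⟨i, hi, h1, h2⟩ := ih (fun i hi => hstep i (by omega)) fun i hi => hup i (by omega)
    rcases hstep m (by omega) with h | h
    · refine ⟨i, by omega, h1, fun j hij hj => ?_⟩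
      rcases Nat.lt_or_ge j (m + 1) with hj' | hj'
      · exact h2 j hij (by omega)
      · obtain rfl : j = m + 1 := by omega
        have := h2 m hi le_rfl
        omega
    · have him : i = m := by
        by_contra hne
        have h3 := h2 m hi le_rfl
        have h4 := h2 (m - 1) (by omega) (by omega)
        have h5 := hup (m - 1) (by omega)
        rw [show m - 1 + 1 = m by omega, show m - 1 + 2 = m + 1 by omega] at h5
        omega
      subst him
      refine ⟨i + 1, le_rfl, fun j hj => ?_, fun j h1 h2 => ?_⟩
      · rcases Nat.lt_or_ge j (i + 1) with hj' | hj'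
        · have := h1 j (by omega)
          omega
        · obtain rfl : j = i + 1 := by omega
          simp
      · obtain rfl : j = i + 1 := by omega
        simp

section Graph

universe u
variable {V : Type u} {T : SimpleGraph V}

/-- Both neighbours start a shortest path from `a` to `x`, and paths in a tree are unique. -/
theorem eq_of_adj_of_dist (hT : T.IsTree) {a u v x : V} (hu : T.Adj a u)
    (hv : T.Adj a v) (hux : T.dist u x + 1 = T.dist a x) (hvx : T.dist v x + 1 = T.dist a x) :
    u = v := by
  obtain ⟨p, hp⟩ := hT.connected.exists_walk_length_eq_dist u x
  obtain ⟨q, hq⟩ := hT.connected.exists_walk_length_eq_dist v x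
  have h1 := (SimpleGraph.Walk.cons hu p).isPath_of_length_eq_dist (by simp [hp, hux])
  have h2 := (SimpleGraph.Walk.cons hv q).isPath_of_length_eq_dist (by simp [hq, hvx])
  have h3 := (hT.existsUnique_path a x).unique h1 h2
  simpa using congrArg SimpleGraph.Walk.snd h3

theorem dist_of_adj (hT : T.IsTree) {a b : V} (h : T.Adj a b) (x : V) :
    T.dist x b = T.dist x a + 1 ∨ T.dist x a = T.dist x b + 1 := by
  have := hT.dist_eq_dist_add_one_of_adj x h
  omega

theorem exists_geodesic (hT : T.Connected) (z w : V) : ∃ g : ℕ → V, g 0 = z ∧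
    g (T.dist z w) = w ∧ (∀ i < T.dist z w, T.Adj (g i) (g (i + 1))) ∧
    ∀ i j, i ≤ j → j ≤ T.dist z w → T.dist (g i) (g j) = j - i := by
  obtain ⟨p, hp⟩ := hT.exists_walk_length_eq_dist z w
  have hadj : ∀ i < T.dist z w, T.Adj (p.getVert i) (p.getVert (i + 1)) := fun i hi =>
    p.adj_getVert_succ (by omega)
  have hle : ∀ i n, i + n ≤ T.dist z w → T.dist (p.getVert i) (p.getVert (i + n)) ≤ n := by
    intro i n
    induction n with
    | zero => simp
    | succ n ih =>
      intro h
      have h1 := ih (by omega)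
      have h2 := hT.dist_triangle (u := p.getVert i) (v := p.getVert (i + n))
        (w := p.getVert (i + (n + 1)))
      have h3 := SimpleGraph.dist_eq_one_iff_adj.2 (hadj (i + n) (by omega))
      rw [← add_assoc] at *
      omega
  refine ⟨p.getVert, by simp, by rw [← hp]; simp, hadj, fun i j hij hj => ?_⟩
  have h1 := hle 0 i (by omega)
  have h2 := hle i (j - i) (by omega)
  have h3 := hle j (T.dist z w - j) (by omega)
  rw [show i + (j - i) = j by omega] at h2
  rw [show j + (T.dist z w - j) = T.dist z w by omega, ← hp, p.getVert_length, hp] at h3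
  rw [zero_add, p.getVert_zero] at h1
  have h4 := hT.dist_triangle (u := z) (v := p.getVert i) (w := w)
  have h5 := hT.dist_triangle (u := p.getVert i) (v := p.getVert j) (w := w)
  omega

theorem exists_median (hT : T.IsTree) (x : V) {m : ℕ} {g : ℕ → V}
    (hadj : ∀ i < m, T.Adj (g i) (g (i + 1)))
    (hg : ∀ i j, i ≤ j → j ≤ m → T.dist (g i) (g j) = j - i) :
    ∃ i ≤ m, T.dist x (g 0) = T.dist x (g i) + i ∧
      T.dist x (g m) = T.dist x (g i) + (m - i) := by
  obtain ⟨i, hi, h1, h2⟩ := exists_valley (fun i => T.dist x (g i)) m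
    (fun i hi => dist_of_adj hT (hadj i hi) x) (fun i hi h => by
      refine (dist_of_adj hT (hadj (i + 1) (by omega)) x).resolve_right fun h' => ?_
      have e1 := T.dist_comm (u := x) (v := g i)
      have e2 := T.dist_comm (u := x) (v := g (i + 1))
      have e3 := T.dist_comm (u := x) (v := g (i + 1 + 1))
      have := eq_of_adj_of_dist hT (hadj i (by omega)).symm (hadj (i + 1) (by omega)) (x := x)
        (by omega) (by omega)
      have h3 := hg i (i + 1 + 1) (by omega) (by omega)
      rw [← this, SimpleGraph.dist_self] at h3
      omega)
  exact ⟨i, hi, by simpa using h1 0 (by omega), h2 m hi le_rfl⟩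

theorem isTreeMetric_dist (hT : T.IsTree) : IsTreeMetric T.dist where
  self _ := SimpleGraph.dist_self
  eq_of_zero x y h := (hT.connected.dist_eq_zero_iff).1 h
  symm _ _ := SimpleGraph.dist_comm
  tri _ _ _ := hT.connected.dist_triangle
  fourPoint x y z w := by
    -- Project `x` and `y` onto a geodesic from `z` to `w` and compare the positions `i` and `j` of
    -- the projections.
    obtain ⟨g, h0, h1, hadj, hg⟩ := exists_geodesic hT.connected z w
    obtain ⟨i, hi, hi1, hi2⟩ := exists_median hT x hadj hg
    obtain ⟨j, hj, hj1, hj2⟩ := exists_median hT y hadj hg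
    rw [h0] at hi1 hj1
    rw [h1] at hi2 hj2
    have h2 := hT.connected.dist_triangle (u := x) (v := g i) (w := y)
    have h3 := hT.connected.dist_triangle (u := g i) (v := g j) (w := y)
    have e1 := T.dist_comm (u := g j) (v := y)
    have e2 := T.dist_comm (u := g i) (v := g j)
    have e3 := T.dist_comm (u := y) (v := z)
    rcases le_total i j with hij | hij
    · have := hg i j hij hj
      omega
    · have := hg j i hij hi
      omega
  even x y z := by
    -- Each step of a walk changes the distance to `x` by exactly one, so the length of the walk has
    -- the parity of the change.
    have key : ∀ {y z : V} (p : T.Walk y z), ∃ m, T.dist x y + p.length + T.dist x z = 2 * m := by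
      intro y z p
      induction p with
      | nil => exact ⟨_, by rw [SimpleGraph.Walk.length_nil, add_zero, two_mul]⟩
      | @cons y w z h p ih =>
        obtain ⟨m, hm⟩ := ih
        rw [SimpleGraph.Walk.length_cons]
        rcases dist_of_adj hT h x with h | h
        · exact ⟨m, by omega⟩
        · exact ⟨m + 1, by omega⟩
    obtain ⟨p, hp⟩ := hT.connected.exists_walk_length_eq_dist y z
    rw [← hp]
    exact key p

variable [Fintype V]

theorem isGeodesic_univ (hT : T.Connected) : IsGeodesic T.dist univ := by
  intro x _ y _ i hi
  obtain ⟨g, h0, h1, -, hg⟩ := exists_geodesic hT x y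
  refine ⟨g i, mem_univ _, ?_, ?_⟩
  · have := hg 0 i (by omega) hi
    rw [h0] at this
    omega
  · have := hg i _ hi le_rfl
    rw [h1] at this
    omega

theorem ediam_ne_top (hT : T.Connected) : T.ediam ≠ ⊤ := by
  have := hT.nonempty
  exact SimpleGraph.connected_iff_ediam_ne_top.1 hT

theorem hasDiam_univ (hT : T.Connected) : HasDiam T.dist univ T.diam := by
  have := hT.nonempty
  refine ⟨fun x _ y _ => SimpleGraph.dist_le_diam (ediam_ne_top hT), ?_⟩
  obtain ⟨u, v, h⟩ := T.exists_dist_eq_diam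
  exact ⟨u, mem_univ _, v, mem_univ _, h⟩

theorem mdi_eq {k s : ℕ} (hks : k + 1 = 2 * s) (T : SimpleGraph V) :
    mdi T k = (maxSpreads (Far T.dist s) univ).card := by
  have hdis : ∀ J : Finset V, IsDIS T k (J : Set V) ↔ Spread (Far T.dist s) J := by
    intro J
    simp only [IsDIS, Spread, Far, hks, mem_coe]
  have h : {J : Set V | IsMDIS T k J} =
      (fun J : Finset V => (J : Set V)) '' (maxSpreads (Far T.dist s) univ : Set (Finset V)) := by
    ext J
    simp only [Set.mem_ofPred_eq, Set.mem_image, mem_coe, mem_maxSpreads]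
    have hfin : J.Finite := Set.toFinite J
    lift J to Finset V using hfin
    have hfs : ∀ x y, Far T.dist s x y → Far T.dist s y x := by
      intro x y h
      unfold Far at *
      rwa [SimpleGraph.dist_comm]
    constructor
    · intro h
      refine ⟨J, ⟨subset_univ _, (hdis J).1 h.prop, fun x _ hx => ?_⟩, rfl⟩
      by_contra! hcon
      classical
      have h1 : IsDIS T k ((insert x J : Finset V) : Set V) := by
        rw [hdis]
        intro a ha b hb hab
        rw [mem_insert] at ha hb
        rcases ha with rfl | ha <;> rcases hb with rfl | hb
        · exact absurd rfl hab
        · exact hcon b hb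
        · exact hfs _ _ (hcon a ha)
        · exact (hdis J).1 h.prop a ha b hb hab
      exact hx (by simpa using h.le_of_ge h1 (by simp) (show x ∈ _ by simp))
    · rintro ⟨K, hK, hKJ⟩
      rw [Finset.coe_inj] at hKJ
      subst hKJ
      refine ⟨(hdis K).2 hK.spread, fun I hI hle x hx => ?_⟩
      by_contra hxK
      obtain ⟨y, hy, hxy⟩ := hK.exists_not_far x (mem_univ _) hxK
      refine hxy ?_
      have := hI x hx y (hle hy) (by rintro rfl; exact hxK hy)
      unfold Far
      omega
  rw [mdi, h, Set.ncard_image_of_injective _ Finset.coe_injective, Set.ncard_coe_finset]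

end Graph

/-! ### Twins and special pairs in terms of distances -/

section Twins

universe u
variable {V : Type u} {T : SimpleGraph V} {k s : ℕ}

theorem coe_dist (hT : T.Connected) (x y : V) : (T.dist x y : ℕ∞) = T.edist x y :=
  (hT x y).coe_dist_eq_edist

theorem dist_lt_of_closedNbhd_eq (hks : k + 1 = 2 * s) {x y : V}
    (h : closedNbhd T k x = closedNbhd T k y) : T.dist x y < 2 * s := by
  have : y ∈ closedNbhd T k x := by
    rw [h]
    simp [closedNbhd]
  have : T.dist x y ≤ k := this
  omega

variable [Fintype V]

theorem Reaches.isLeaf (hT : T.IsTree) (hD : 1 ≤ T.diam) {v : V}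
    (hv : Reaches T.dist univ T.diam v) : IsLeaf T v := by
  obtain ⟨-, w, -, hw⟩ := hv
  obtain ⟨g, h0, h1, hadj, hg⟩ := exists_geodesic hT.connected v w
  have h2 := hadj 0 (by omega)
  rw [h0, zero_add] at h2
  have key : ∀ u, T.Adj v u → T.dist u w + 1 = T.dist v w := by
    intro u hu
    have h3 := (hasDiam_univ hT.connected).le u (mem_univ _) w (mem_univ _)
    have e1 := T.dist_comm (u := u) (v := w)
    have e2 := T.dist_comm (u := v) (v := w)
    rcases dist_of_adj hT hu w with h | h <;> omega
  rw [IsLeaf, Set.ncard_eq_one]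
  refine ⟨g 1, Set.eq_singleton_iff_unique_mem.2 ⟨h2, fun u hu => ?_⟩⟩
  exact eq_of_adj_of_dist hT hu h2 (key u hu) (key _ h2)

theorem reaches_iff_eccent (hT : T.Connected) {v : V} :
    Reaches T.dist univ T.diam v ↔ T.ediam ≤ T.eccent v := by
  have := hT.nonempty
  have hdiam : (T.diam : ℕ∞) = T.ediam := ENat.natCast_toNat (ediam_ne_top hT)
  constructor
  · rintro ⟨-, w, -, hw⟩
    rw [← hdiam, ← hw, coe_dist hT]
    exact SimpleGraph.edist_le_eccent
  · intro h
    obtain ⟨w, hw⟩ := T.exists_edist_eq_eccent_of_finite v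
    refine ⟨mem_univ _, w, mem_univ _, ?_⟩
    rw [← hw, ← hdiam, ← coe_dist hT, Nat.cast_le] at h
    exact le_antisymm ((hasDiam_univ hT).le _ (mem_univ _) _ (mem_univ _)) h

/-- Ends of diametral paths are leaves, so the maximum eccentricity among leaves is the diameter. -/
theorem isDiametralLeaf_iff (hT : T.IsTree) (hD : 1 ≤ T.diam) {v : V} :
    IsDiametralLeaf T v ↔ Reaches T.dist univ T.diam v := by
  constructor
  · rintro ⟨-, h⟩
    obtain ⟨a, ha, b, hb, hab⟩ := (hasDiam_univ hT.connected).exists_eq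
    have hr : Reaches T.dist univ T.diam a := ⟨ha, b, hb, hab⟩
    rw [reaches_iff_eccent hT.connected] at hr ⊢
    exact hr.trans (h a (((reaches_iff_eccent hT.connected).2 hr).isLeaf hT hD))
  · intro h
    exact ⟨h.isLeaf hT hD, fun w _ => SimpleGraph.eccent_le_ediam.trans
      ((reaches_iff_eccent hT.connected).1 h)⟩

theorem closedNbhd_eq_of_close (hT : T.IsTree) (hks : k + 1 = 2 * s) (hD : 2 * s ≤ T.diam) {x y : V}
    (hx : Reaches T.dist univ T.diam x) (hy : Reaches T.dist univ T.diam y)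
    (h : T.dist x y < 2 * s) : closedNbhd T k x = closedNbhd T k y := by
  have hd := isTreeMetric_dist hT
  have hS := hasDiam_univ hT.connected
  obtain ⟨hx, w, hw, hxw⟩ := hx
  obtain ⟨hy, w', hw', hyw⟩ := hy
  have h1 := (hd.far_of_twin hD hS.le hx hy hw hw' hxw hyw h).2
  have h2 := (hd.far_of_twin hD hS.le hy hx hw' hw hyw hxw (by rwa [T.dist_comm])).2
  ext z
  have e1 := T.dist_comm (u := x) (v := z)
  have e2 := T.dist_comm (u := y) (v := z)
  have h3 := h1 z (mem_univ _)
  have h4 := h2 z (mem_univ _)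
  simp only [closedNbhd, Set.mem_ofPred_eq]
  omega

/-- The twin of a diametral leaf need not be a leaf by definition; at these two diameters it is
diametral as well. It is far from `w` and from the point `w₁` at distance `2 * s` from `x`. At the
odd diameter these are neighbours, so by parity one of the two distances is `2 * s + 1`. -/
theorem Reaches.of_closedNbhd_eq (hT : T.IsTree) (hks : k + 1 = 2 * s)
    (hD : 2 * s ≤ T.diam) (hD' : T.diam ≤ 2 * s + 1) {x y : V} (hx : Reaches T.dist univ T.diam x)
    (h : closedNbhd T k x = closedNbhd T k y) : Reaches T.dist univ T.diam y := by
  have hd := isTreeMetric_dist hT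
  have hS := hasDiam_univ hT.connected
  have far : ∀ z, 2 * s ≤ T.dist x z → 2 * s ≤ T.dist y z := by
    intro z hz
    by_contra hcon
    have : z ∈ closedNbhd T k x := by
      rw [h]
      simp only [closedNbhd, Set.mem_ofPred_eq]
      omega
    simp only [closedNbhd, Set.mem_ofPred_eq] at this
    omega
  obtain ⟨-, w, -, hxw⟩ := hx
  obtain ⟨w₁, -, h1, h2⟩ := isGeodesic_univ hT.connected x (mem_univ _) w (mem_univ _)
    (2 * s) (by omega)
  have h3 := far w (by omega)
  have h4 := far w₁ (by omega)
  have h5 := hS.le y (mem_univ _) w (mem_univ _)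
  have h6 := hS.le y (mem_univ _) w₁ (mem_univ _)
  obtain ⟨m, hm⟩ := hd.even y w₁ w
  refine ⟨mem_univ _, ?_⟩
  by_cases h7 : T.dist y w = T.diam
  · exact ⟨w, mem_univ _, h7⟩
  · exact ⟨w₁, mem_univ _, by omega⟩

theorem exists_isDiametralTwin_iff (hT : T.IsTree) (hks : k + 1 = 2 * s)
    (hD : 2 * s ≤ T.diam) (hD' : T.diam ≤ 2 * s + 1) :
    (∃ x, IsDiametralTwin T k x) ↔ ¬ TwinFree T.dist univ s T.diam := by
  unfold TwinFree
  push Not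
  constructor
  · rintro ⟨x, hx, y, hyx, hN⟩
    rw [isDiametralLeaf_iff hT (by omega)] at hx
    exact ⟨x, y, hx, hx.of_closedNbhd_eq hT hks hD hD' hN, dist_lt_of_closedNbhd_eq hks hN,
      hyx.symm⟩
  · rintro ⟨x, y, hx, hy, hxy, hne⟩
    exact ⟨x, (isDiametralLeaf_iff hT (by omega)).2 hx, y, hne.symm,
      closedNbhd_eq_of_close hT hks hD hx hy hxy⟩

theorem exists_isSpecialPair_iff (hT : T.IsTree) (hks : k + 1 = 2 * s)
    (hD : 2 * s ≤ T.diam) (hD' : T.diam ≤ 2 * s + 1) :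
    (∃ x y, IsSpecialPair T k x y) ↔ ¬ SpecialFree T.dist univ s T.diam := by
  unfold SpecialFree
  push Not
  constructor
  · rintro ⟨x, y, ⟨hx, x', hxx, hNx⟩, ⟨hy, y', hyy, hNy⟩, hN⟩
    rw [isDiametralLeaf_iff hT (by omega)] at hx hy
    refine ⟨x, x', y, y', hx, hx.of_closedNbhd_eq hT hks hD hD' hNx, hy,
      hy.of_closedNbhd_eq hT hks hD hD' hNy, hxx.symm, hyy.symm,
      dist_lt_of_closedNbhd_eq hks hNx, dist_lt_of_closedNbhd_eq hks hNy, ?_⟩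
    by_contra! hcon
    exact hN (closedNbhd_eq_of_close hT hks hD hy hx hcon).symm
  · rintro ⟨v, v', u, u', hv, hv', hu, hu', hvv, huu, dvv, duu, duv⟩
    refine ⟨v, u, ⟨(isDiametralLeaf_iff hT (by omega)).2 hv, v', hvv.symm,
      closedNbhd_eq_of_close hT hks hD hv hv' dvv⟩,
      ⟨(isDiametralLeaf_iff hT (by omega)).2 hu, u', huu.symm,
      closedNbhd_eq_of_close hT hks hD hu hu' duu⟩, fun h => ?_⟩
    have := dist_lt_of_closedNbhd_eq hks h
    rw [T.dist_comm] at this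
    omega

end Twins

/-! ### Star-like and double star-like trees -/

section Construct

universe u v
variable {V : Type u} {T : SimpleGraph V}

/-- A walk without immediate reversals in a tree is a geodesic. -/
theorem dist_of_not_backtracking (hT : T.IsTree) {m : ℕ} {g : ℕ → V}
    (hadj : ∀ i < m, T.Adj (g i) (g (i + 1))) (hne : ∀ i, i + 2 ≤ m → g i ≠ g (i + 2)) :
    T.dist (g 0) (g m) = m := by
  have key : ∀ i < m, T.dist (g 0) (g (i + 1)) = T.dist (g 0) (g i) + 1 := by
    intro i
    induction i with
    | zero =>
      intro h
      rw [SimpleGraph.dist_self, SimpleGraph.dist_eq_one_iff_adj]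
      exact hadj 0 h
    | succ i ih =>
      intro h
      have h1 := ih (by omega)
      refine (dist_of_adj hT (hadj (i + 1) h) (g 0)).resolve_right fun h2 => hne i (by omega) ?_
      have e1 := T.dist_comm (u := g 0) (v := g i)
      have e2 := T.dist_comm (u := g 0) (v := g (i + 1))
      have e3 := T.dist_comm (u := g 0) (v := g (i + 1 + 1))
      change g i = g (i + 1 + 1)
      exact eq_of_adj_of_dist hT (hadj i (by omega)).symm (hadj (i + 1) h) (x := g 0) (by omega)
        (by omega)
  have : ∀ i ≤ m, T.dist (g 0) (g i) = i := by
    intro i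
    induction i with
    | zero => simp
    | succ i ih =>
      intro h
      rw [key i (by omega), ih (by omega)]
  exact this m le_rfl

/-- Geodesics leaving `c` through different neighbours concatenate to a geodesic. -/
theorem dist_of_ne_of_adj (hT : T.IsTree) {c u u' x y : V} (hu : T.Adj c u) (hu' : T.Adj c u')
    (hne : u ≠ u') (hx : T.dist u x + 1 = T.dist c x) (hy : T.dist u' y + 1 = T.dist c y) :
    T.dist x y = T.dist c x + T.dist c y := by
  have hd := isTreeMetric_dist hT
  have e1 := hd.symm x u'
  have e2 := hd.symm x c
  have h1 : T.dist u' x = T.dist c x + 1 := by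
    rcases dist_of_adj hT hu' x with h | h
    · omega
    · exact absurd (eq_of_adj_of_dist hT hu hu' hx (by omega)) hne
  have h2 := SimpleGraph.dist_eq_one_iff_adj.2 hu'
  have h3 := hd.fourPoint x u' c y
  have h4 := hd.tri x c y
  have e3 := hd.symm u' c
  omega

/-- Following parents gives connectedness, and every edge joins a non-root to its parent, so there
are at most `|W| - 1` edges. -/
theorem isTree_of_parent {W : Type v} [Finite W] {G : SimpleGraph W} (r : W) (par : W → W)
    (depth : W → ℕ) (hpar : ∀ w, w ≠ r → G.Adj w (par w)) (hdepth : ∀ w, w ≠ r → depth (par w) < depth w)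
    (hadj : ∀ a b, G.Adj a b → (a ≠ r ∧ b = par a) ∨ (b ≠ r ∧ a = par b)) : G.IsTree := by
  have hreach : ∀ n w, depth w = n → G.Reachable w r := by
    intro n
    induction n using Nat.strong_induction_on with
    | _ n ih =>
      intro w hw
      by_cases hwr : w = r
      · rw [hwr]
      · exact (hpar w hwr).reachable.trans (ih _ (hw ▸ hdepth w hwr) _ rfl)
  have hconn : G.Connected := by
    have : Nonempty W := ⟨r⟩
    exact ⟨fun a b => (hreach _ a rfl).trans (hreach _ b rfl).symm⟩
  rw [SimpleGraph.isTree_iff_connected_and_card]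
  refine ⟨hconn, le_antisymm ?_ hconn.card_vert_le_card_edgeSet_add_one⟩
  have hsub : G.edgeSet ⊆ (fun w => s(w, par w)) '' {r}ᶜ := by
    intro e
    induction e using Sym2.ind with
    | _ a b =>
      intro h
      rcases hadj a b h with ⟨h1, h2⟩ | ⟨h1, h2⟩
      · exact ⟨a, h1, by simp [h2]⟩
      · exact ⟨b, h1, by simp [h2, Sym2.eq_swap]⟩
  have h1 := (Set.ncard_le_ncard hsub (Set.toFinite _)).trans (Set.ncard_image_le (Set.toFinite _))
  have h2 := Set.ncard_add_ncard_compl ({r} : Set W)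
  rw [Set.ncard_singleton] at h2
  rw [Nat.card_coe_set_eq]
  omega

/-- `φ` maps the star-like tree into `T`. -/
structure IsStarMap {p m : ℕ} (T : SimpleGraph V) (φ : Option (Fin p × Fin m) → V) : Prop where
  adj_none : ∀ i (h : 0 < m), T.Adj (φ none) (φ (some (i, ⟨0, h⟩)))
  adj_some : ∀ i j (h : j + 1 < m), T.Adj (φ (some (i, ⟨j, by omega⟩))) (φ (some (i, ⟨j + 1, h⟩)))

variable {p m : ℕ}

theorem isStarMap_id (p m : ℕ) : IsStarMap (starLike p m) id := by
  refine ⟨fun i h => ?_, fun i j h => ?_⟩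
  · simp [starLike]
  · simp [starLike]

theorem IsStarMap.map_adj {φ : Option (Fin p × Fin m) → V} (h : IsStarMap T φ)
    {a b : Option (Fin p × Fin m)} (hab : (starLike p m).Adj a b) : T.Adj (φ a) (φ b) := by
  have key : ∀ a b : Option (Fin p × Fin m), (match a, b with
      | none, some b => (b.2 : ℕ) = 0
      | some a, some b => a.1 = b.1 ∧ (a.2 : ℕ) + 1 = (b.2 : ℕ)
      | _, none => False) → T.Adj (φ a) (φ b) := by
    rintro (_ | ⟨i, j⟩) (_ | ⟨i', j'⟩) hr
    · exact hr.elim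
    · obtain ⟨j', hj'⟩ := j'
      simp only at hr
      subst hr
      exact h.adj_none i' hj'
    · exact hr.elim
    · obtain ⟨j', hj'⟩ := j'
      obtain ⟨j, hj⟩ := j
      simp only at hr
      obtain ⟨rfl, rfl⟩ := hr
      exact h.adj_some i j hj'
  rw [starLike, SimpleGraph.fromRel_adj] at hab
  rcases hab.2 with h1 | h1
  · exact key _ _ h1
  · exact (key _ _ h1).symm

theorem IsStarMap.of_hom {W : Type v} {G : SimpleGraph W} {ψ : Option (Fin p × Fin m) → W}
    (hψ : IsStarMap G ψ) (φ : G →g T) : IsStarMap T (φ ∘ ψ) :=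
  ⟨fun i h => φ.map_rel (hψ.adj_none i h), fun i j h => φ.map_rel (hψ.adj_some i j h)⟩

theorem IsStarMap.isContained {φ : Option (Fin p × Fin m) → V} (h : IsStarMap T φ)
    (hφ : Function.Injective φ) : (starLike p m).IsContained T :=
  ⟨⟨⟨φ, fun hab => h.map_adj hab⟩, hφ⟩⟩

theorem IsStarMap.dist_none (hT : T.IsTree) {φ : Option (Fin p × Fin m) → V} (h : IsStarMap T φ)
    (hφ : Function.Injective φ) (i : Fin p) (j : Fin m) :
    T.dist (φ none) (φ (some (i, j))) = j + 1 ∧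
      T.dist (φ (some (i, ⟨0, j.pos⟩))) (φ (some (i, j))) = j := by
  have hm := j.pos
  let g : ℕ → V := fun a => φ (some (i, ⟨min a (m - 1), by omega⟩))
  let g' : ℕ → V := fun a => if a = 0 then φ none else g (a - 1)
  have hg' : ∀ a, g' (a + 1) = g a := fun a => rfl
  have hg0 : g' 0 = φ none := rfl
  have hg : ∀ a (h : a < m), g a = φ (some (i, ⟨a, h⟩)) := by
    intro a h
    simp only [g]
    congr 5
    omega
  have hgadj : ∀ a < j.val, T.Adj (g a) (g (a + 1)) := by
    intro a ha
    rw [hg a (by omega), hg (a + 1) (by omega)]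
    exact h.adj_some i a (by omega)
  have hgne : ∀ a, a + 2 ≤ j.val → g a ≠ g (a + 2) := by
    intro a ha he
    rw [hg a (by omega), hg (a + 2) (by omega)] at he
    have := hφ he
    simp at this
  constructor
  · have h1 := dist_of_not_backtracking hT (m := j.val + 1) (g := g') (by
      rintro (_ | a) ha
      · rw [hg', hg0, hg 0 hm]
        exact h.adj_none i hm
      · exact hgadj a (by omega)) (by
      rintro (_ | a) ha
      · intro he
        rw [hg', hg0, hg _ (by omega)] at he
        have := hφ he
        simp at this
      · exact hgne a (by omega))
    rw [hg', hg0, hg j.val j.2] at h1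
    exact h1
  · have h1 := dist_of_not_backtracking hT hgadj hgne
    rw [hg 0 hm, hg j.val j.2] at h1
    exact h1

theorem IsStarMap.dist_ends (hT : T.IsTree) {φ : Option (Fin p × Fin m) → V} (h : IsStarMap T φ)
    (hφ : Function.Injective φ) {i i' : Fin p} (hi : i ≠ i') (j j' : Fin m) :
    T.dist (φ (some (i, j))) (φ (some (i', j'))) = j + 1 + (j' + 1) := by
  obtain ⟨h1, h2⟩ := h.dist_none hT hφ i j
  obtain ⟨h3, h4⟩ := h.dist_none hT hφ i' j'
  have h5 := dist_of_ne_of_adj hT (h.adj_none i j.pos) (h.adj_none i' j'.pos)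
    (fun he => hi (by simpa using hφ he)) (x := φ (some (i, j))) (y := φ (some (i', j')))
    (by omega) (by omega)
  omega

/-- The neighbour of a vertex of the star-like tree on the way to the centre. -/
def starParent (p m : ℕ) : Option (Fin p × Fin m) → Option (Fin p × Fin m)
  | none => none
  | some (i, j) => if (j : ℕ) = 0 then none else some (i, ⟨j - 1, by omega⟩)

/-- The distance of a vertex of the star-like tree from the centre. -/
def starDepth (p m : ℕ) : Option (Fin p × Fin m) → ℕ
  | none => 0
  | some (_, j) => j + 1

theorem starLike_adj_starParent (w : Option (Fin p × Fin m)) (hw : w ≠ none) :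
    (starLike p m).Adj w (starParent p m w) := by
  rcases w with _ | ⟨i, j, hj⟩
  · exact absurd rfl hw
  · rcases j with _ | j
    · exact ((isStarMap_id p m).adj_none i hj).symm
    · exact ((isStarMap_id p m).adj_some i j hj).symm

theorem starDepth_starParent_lt (w : Option (Fin p × Fin m)) (hw : w ≠ none) :
    starDepth p m (starParent p m w) < starDepth p m w := by
  rcases w with _ | ⟨i, j, hj⟩
  · exact absurd rfl hw
  · rcases j with _ | j <;> simp [starParent, starDepth]

theorem eq_starParent_of_adj {a b : Option (Fin p × Fin m)} (hab : (starLike p m).Adj a b) :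
    (a ≠ none ∧ b = starParent p m a) ∨ (b ≠ none ∧ a = starParent p m b) := by
  rw [starLike, SimpleGraph.fromRel_adj] at hab
  have key : ∀ a b : Option (Fin p × Fin m), (match a, b with
      | none, some b => (b.2 : ℕ) = 0
      | some a, some b => a.1 = b.1 ∧ (a.2 : ℕ) + 1 = (b.2 : ℕ)
      | _, none => False) → b ≠ none ∧ a = starParent p m b := by
    rintro (_ | ⟨i, j, hj⟩) (_ | ⟨i', j', hj'⟩) hr
    · exact hr.elim
    · simp only at hr
      subst hr
      simp [starParent]
    · exact hr.elim
    · simp only at hr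
      obtain ⟨rfl, rfl⟩ := hr
      simp [starParent]
  rcases hab.2 with h1 | h1
  · exact Or.inr (key _ _ h1)
  · exact Or.inl (key _ _ h1)

theorem starLike_isTree (p m : ℕ) : (starLike p m).IsTree :=
  isTree_of_parent none (starParent p m) (starDepth p m) starLike_adj_starParent
    starDepth_starParent_lt fun _ _ h => eq_starParent_of_adj h

theorem IsStarMap.doubleStarLike_map_adj {q : ℕ} {φ : Option (Fin p × Fin m) → V}
    {ψ : Option (Fin q × Fin m) → V} (hφ : IsStarMap T φ) (hψ : IsStarMap T ψ)
    (h : T.Adj (φ none) (ψ none)) {a b} (hab : (doubleStarLike p q m).Adj a b) :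
    T.Adj (Sum.elim φ ψ a) (Sum.elim φ ψ b) := by
  rw [doubleStarLike, SimpleGraph.sup_adj, SimpleGraph.edge_adj] at hab
  rcases hab with hab | ⟨⟨rfl, rfl⟩ | ⟨rfl, rfl⟩, -⟩
  · rcases a with a | a <;> rcases b with b | b
    · exact hφ.map_adj (by simpa using hab)
    · simp at hab
    · simp at hab
    · exact hψ.map_adj (by simpa using hab)
  · exact h
  · exact h.symm

theorem doubleStarLike_adj_inl (q : ℕ) {a b : Option (Fin p × Fin m)}
    (h : (starLike p m).Adj a b) : (doubleStarLike p q m).Adj (Sum.inl a) (Sum.inl b) :=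
  Or.inl (by simpa using h)

theorem doubleStarLike_adj_inr {q : ℕ} (p : ℕ) {a b : Option (Fin q × Fin m)}
    (h : (starLike q m).Adj a b) : (doubleStarLike p q m).Adj (Sum.inr a) (Sum.inr b) :=
  Or.inl (by simpa using h)

theorem isStarMap_inl (p q m : ℕ) : IsStarMap (doubleStarLike p q m) Sum.inl := by
  refine ⟨fun i h => ?_, fun i j h => ?_⟩
  · exact doubleStarLike_adj_inl q ((isStarMap_id p m).adj_none i h)
  · exact doubleStarLike_adj_inl q ((isStarMap_id p m).adj_some i j h)

theorem isStarMap_inr (p q m : ℕ) : IsStarMap (doubleStarLike p q m) Sum.inr := by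
  refine ⟨fun i h => ?_, fun i j h => ?_⟩
  · exact doubleStarLike_adj_inr p ((isStarMap_id q m).adj_none i h)
  · exact doubleStarLike_adj_inr p ((isStarMap_id q m).adj_some i j h)

theorem doubleStarLike_adj_none (p q m : ℕ) :
    (doubleStarLike p q m).Adj (Sum.inl none) (Sum.inr none) := by
  simp [doubleStarLike, SimpleGraph.edge_adj]

theorem doubleStarLike_isTree (p q m : ℕ) : (doubleStarLike p q m).IsTree := by
  refine isTree_of_parent (Sum.inl none)
    (Sum.elim (fun a => Sum.inl (starParent p m a))
      (fun a => if a = none then Sum.inl none else Sum.inr (starParent q m a)))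
    (Sum.elim (starDepth p m) (fun a => starDepth q m a + 1)) ?_ ?_ ?_
  · rintro (a | a) hw
    · exact doubleStarLike_adj_inl q (starLike_adj_starParent a (fun h => hw (by rw [h])))
    · by_cases ha : a = none
      · subst ha
        simpa using (doubleStarLike_adj_none p q m).symm
      · simpa [ha] using doubleStarLike_adj_inr p (starLike_adj_starParent a ha)
  · rintro (a | a) hw
    · simpa using starDepth_starParent_lt a (fun h => hw (by rw [h]))
    · by_cases ha : a = none
      · subst ha
        simp [starDepth]
      · simpa [ha] using starDepth_starParent_lt a ha
  · intro a b hab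
    rw [doubleStarLike, SimpleGraph.sup_adj, SimpleGraph.edge_adj] at hab
    rcases hab with hab | ⟨⟨rfl, rfl⟩ | ⟨rfl, rfl⟩, -⟩
    · rcases a with a | a <;> rcases b with b | b
      · simpa using eq_starParent_of_adj (show (starLike p m).Adj a b by simpa using hab)
      · simp at hab
      · simp at hab
      · rcases eq_starParent_of_adj (show (starLike q m).Adj a b by simpa using hab) with
          ⟨h1, h2⟩ | ⟨h1, h2⟩
        · exact Or.inl (by simp [h1, h2])
        · exact Or.inr (by simp [h1, h2])
    · exact Or.inr (by simp)
    · exact Or.inl (by simp)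

theorem IsStarMap.dist_cross (hT : T.IsTree) {q : ℕ} {φ : Option (Fin p × Fin m) → V}
    {ψ : Option (Fin q × Fin m) → V} (hφ : IsStarMap T φ) (hψ : IsStarMap T ψ)
    (h : T.Adj (φ none) (ψ none)) (hinj : Function.Injective (Sum.elim φ ψ))
    (i : Fin p) (i' : Fin q) (j j' : Fin m) :
    T.dist (φ (some (i, j))) (ψ (some (i', j'))) = j + 1 + (j' + 2) := by
  have hφi : Function.Injective φ := fun a b h => by
    simpa using @hinj (Sum.inl a) (Sum.inl b) h
  have hψi : Function.Injective ψ := fun a b h => by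
    simpa using @hinj (Sum.inr a) (Sum.inr b) h
  have hne : ∀ a b, φ a ≠ ψ b := fun a b h => by
    simpa using @hinj (Sum.inl a) (Sum.inr b) h
  obtain ⟨h1, h2⟩ := hφ.dist_none hT hφi i j
  obtain ⟨h3, h4⟩ := hψ.dist_none hT hψi i' j'
  have h5 : T.dist (φ none) (ψ (some (i', j'))) = j' + 2 := by
    have e1 := T.dist_comm (u := φ none) (v := ψ (some (i', j')))
    have e2 := T.dist_comm (u := ψ none) (v := ψ (some (i', j')))
    rcases dist_of_adj hT h (ψ (some (i', j'))) with h6 | h6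
    · exact absurd (eq_of_adj_of_dist hT h.symm (hψ.adj_none i' j'.pos)
        (x := ψ (some (i', j'))) (by omega) (by omega)) (hne _ _)
    · omega
  have h6 := dist_of_ne_of_adj hT (hφ.adj_none i j.pos) h (hne _ _)
    (x := φ (some (i, j))) (y := ψ (some (i', j'))) (by omega) (by omega)
  omega

theorem IsStarMap.dist_none_le (hT : T.IsTree) {φ : Option (Fin p × Fin m) → V} (h : IsStarMap T φ)
    (hφ : Function.Injective φ) (a : Option (Fin p × Fin m)) : T.dist (φ none) (φ a) ≤ m := by
  rcases a with _ | ⟨i, j⟩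
  · simp
  · have := (h.dist_none hT hφ i j).1
    omega

theorem diam_starLike (hp : 2 ≤ p) (hm : 1 ≤ m) : (starLike p m).diam = 2 * m := by
  have hT := starLike_isTree p m
  have hd := isTreeMetric_dist hT
  refine (hasDiam_univ hT.connected).unique ⟨fun x _ y _ => ?_, ?_⟩
  · have h1 := (isStarMap_id p m).dist_none_le hT Function.injective_id x
    have h2 := (isStarMap_id p m).dist_none_le hT Function.injective_id y
    have h3 := hd.tri x none y
    have h4 := hd.symm x none
    simp only [id] at h1 h2
    omega
  · refine ⟨some (⟨0, by omega⟩, ⟨m - 1, by omega⟩), mem_univ _,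
      some (⟨1, by omega⟩, ⟨m - 1, by omega⟩), mem_univ _, ?_⟩
    have := (isStarMap_id p m).dist_ends hT Function.injective_id (i := ⟨0, by omega⟩)
      (i' := ⟨1, by omega⟩) (by simp) ⟨m - 1, by omega⟩ ⟨m - 1, by omega⟩
    simp only [id] at this
    omega

theorem diam_doubleStarLike {q : ℕ} (hp : 1 ≤ p) (hq : 1 ≤ q) (hm : 1 ≤ m) :
    (doubleStarLike p q m).diam = 2 * m + 1 := by
  have hT := doubleStarLike_isTree p q m
  have hd := isTreeMetric_dist hT
  have hadj := SimpleGraph.dist_eq_one_iff_adj.2 (doubleStarLike_adj_none p q m)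
  refine (hasDiam_univ hT.connected).unique ⟨fun x _ y _ => ?_, ?_⟩
  · have key : ∀ x, (doubleStarLike p q m).dist (Sum.inl none) x ≤ m ∨
        (doubleStarLike p q m).dist (Sum.inr none) x ≤ m := by
      rintro (a | a)
      · exact Or.inl ((isStarMap_inl p q m).dist_none_le hT Sum.inl_injective a)
      · exact Or.inr ((isStarMap_inr p q m).dist_none_le hT Sum.inr_injective a)
    have e1 := hd.symm x (Sum.inl none)
    have e2 := hd.symm x (Sum.inr none)
    have h3 := hd.tri x (Sum.inl none) y
    have h4 := hd.tri x (Sum.inr none) y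
    have h5 := hd.tri (Sum.inl none) (Sum.inr none) y
    have h6 := hd.tri x (Sum.inl none) (Sum.inr none)
    have h7 := hd.tri (Sum.inr none) (Sum.inl none) y
    have e3 := hd.symm (Sum.inl none) (Sum.inr none)
    rcases key x with h | h <;> rcases key y with h' | h' <;> omega
  · refine ⟨Sum.inl (some (⟨0, by omega⟩, ⟨m - 1, by omega⟩)), mem_univ _,
      Sum.inr (some (⟨0, by omega⟩, ⟨m - 1, by omega⟩)), mem_univ _, ?_⟩
    have := (isStarMap_inl p q m).dist_cross hT (isStarMap_inr p q m)
      (doubleStarLike_adj_none p q m) (by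
        rw [Sum.elim_inl_inr]
        exact Function.injective_id)
      ⟨0, by omega⟩ ⟨0, by omega⟩ ⟨m - 1, by omega⟩ ⟨m - 1, by omega⟩
    dsimp only at this
    omega

end Construct

/-! ### Recognising the extremal trees -/

section Extremal

universe u
variable {V : Type u} {T : SimpleGraph V} {k s p q : ℕ}

/-- The ends of the arms of a star-like subtree form a spread set. -/
theorem IsStarMap.exists_spread (hT : T.IsTree) (hs : 1 ≤ s) {φ : Option (Fin p × Fin s) → V}
    (h : IsStarMap T φ) (hφ : Function.Injective φ) :
    ∃ L : Finset V, Spread (Far T.dist s) L ∧ L.card = p ∧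
      ∀ x, x ∈ L ↔ ∃ i, φ (some (i, ⟨s - 1, by omega⟩)) = x := by
  classical
  refine ⟨univ.image fun i => φ (some (i, ⟨s - 1, by omega⟩)), ?_, ?_, by simp⟩
  · intro x hx y hy hxy
    obtain ⟨i, -, rfl⟩ := mem_image.1 hx
    obtain ⟨j, -, rfl⟩ := mem_image.1 hy
    have := h.dist_ends hT hφ (i := i) (i' := j) (by rintro rfl; exact hxy rfl)
      ⟨s - 1, by omega⟩ ⟨s - 1, by omega⟩
    dsimp only at this
    unfold Far
    omega
  · rw [card_image_of_injective, card_univ, Fintype.card_fin]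
    intro i j hij
    simpa using hφ hij

/-- Geodesics of length `s` from `c` to mutually far points form a star-like tree. -/
theorem exists_isStarMap (hT : T.IsTree) {c : V} {l : Fin p → V}
    (hcl : ∀ i, T.dist c (l i) = s) (hl : ∀ i j, i ≠ j → 2 * s ≤ T.dist (l i) (l j)) :
    ∃ φ : Option (Fin p × Fin s) → V, IsStarMap T φ ∧ Function.Injective φ ∧ φ none = c ∧
      ∀ i j, T.dist (φ (some (i, j))) (l i) + j + 1 = s := by
  have hd := isTreeMetric_dist hT
  have key : ∀ i, ∃ g : ℕ → V, g 0 = c ∧ g s = l i ∧ (∀ j < s, T.Adj (g j) (g (j + 1))) ∧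
      ∀ a b, a ≤ b → b ≤ s → T.dist (g a) (g b) = b - a := by
    intro i
    obtain ⟨g, h⟩ := exists_geodesic hT.connected c (l i)
    rw [hcl i] at h
    exact ⟨g, h⟩
  choose g h0 hs hadj hg using key
  have hci : ∀ i, ∀ j : Fin s, T.dist c (g i (j + 1)) = j + 1 := by
    intro i j
    have := hg i 0 (j + 1) (by omega) (by omega)
    rw [h0] at this
    omega
  have hli : ∀ i, ∀ j : Fin s, T.dist (g i (j + 1)) (l i) + j + 1 = s := by
    intro i j
    have := hg i (j + 1) s (by omega) le_rfl
    rw [hs] at this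
    omega
  refine ⟨fun a => a.elim c fun x => g x.1 (x.2 + 1), ⟨fun i h => ?_, fun i j h => ?_⟩, ?_, rfl,
    hli⟩
  · have := hadj i 0 h
    rw [h0] at this
    exact this
  · exact hadj i (j + 1) h
  · rintro (_ | ⟨i, j⟩) (_ | ⟨i', j'⟩) h
    · rfl
    · simp only [Option.elim] at h
      have := hci i' j'
      rw [← h, SimpleGraph.dist_self] at this
      omega
    · simp only [Option.elim] at h
      have := hci i j
      rw [h, SimpleGraph.dist_self] at this
      omega
    · simp only [Option.elim] at h
      have h1 := hci i j
      have h2 := hci i' j'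
      rw [h] at h1
      have hj : j = j' := Fin.ext (by omega)
      subst hj
      by_cases hi : i = i'
      · rw [hi]
      · have h3 := hl i i' hi
        have h4 := hli i j
        -- Arms with a common point of depth `j + 1` would have ends at distance at most `2 * (s - j
        -- - 1) < 2 * s`.
        have h5 := hli i' j
        rw [h] at h4
        have h6 := hd.tri (l i) (g i' (j + 1)) (l i')
        have h7 := hd.symm (l i) (g i' (j + 1))
        omega

variable [Fintype V]

/-- By packing, no spread set has more than `⌊(n - 1) / s⌋` points, so one of that size cannot be
enlarged. -/
theorem isMaxSpread_of_card (hT : T.IsTree) {L : Finset V}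
    (hL : Spread (Far T.dist s) L) (hs : 1 ≤ s) (hL2 : 2 ≤ L.card)
    (hcard : (Fintype.card V - 1) / s ≤ L.card) : IsMaxSpread (Far T.dist s) univ L := by
  have hd := isTreeMetric_dist hT
  classical
  obtain ⟨I, hLI, hI⟩ := hL.exists_isMaxSpread_superset hd.far_symm (subset_univ L)
  have h1 := card_le_card hLI
  have h2 := packing hd (isGeodesic_univ hT.connected) (subset_univ I) hI.spread (by omega)
  rw [card_univ] at h2
  have h3 : I.card ≤ (Fintype.card V - 1) / s := (Nat.le_div_iff_mul_le (by omega)).2 (by omega)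
  rwa [eq_of_subset_of_card_le hLI (by omega)]

theorem mdi_of_contains_starLike (hT : T.IsTree) (hks : k + 1 = 2 * s) (hs : 1 ≤ s)
    (hp : 2 ≤ p) (hpn : (Fintype.card V - 1) / s = p) (hD : T.diam = 2 * s)
    (hc : (starLike p s).IsContained T) (hsp : ¬ ∃ x y, IsSpecialPair T k x y) :
    mdi T k = Fintype.card V - p + 1 := by
  obtain ⟨⟨f, hf⟩⟩ := hc
  have hφ : IsStarMap T (f ∘ id) := (isStarMap_id p s).of_hom f
  obtain ⟨L, hL, hLp, -⟩ := hφ.exists_spread hT hs hf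
  have hmax := isMaxSpread_of_card hT hL hs (by omega) (by omega)
  rw [exists_isSpecialPair_iff hT hks (by omega) (by omega), not_not, hD] at hsp
  have hS := hasDiam_univ hT.connected
  rw [hD] at hS
  rw [mdi_eq hks, card_maxSpreads_even (isTreeMetric_dist hT) hS hsp hmax (by omega), hLp,
    card_univ]

/-- When all vertices but the arm ends are within distance `s - 1` of the centre, the split count
applies directly, with no condition on `n`, the diameter or twins. -/
theorem mdi_of_starMap (hT : T.IsTree) (hks : k + 1 = 2 * s) (hs : 1 ≤ s)
    (hp : 2 ≤ p) {φ : Option (Fin p × Fin s) → V} (h : IsStarMap T φ)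
    (hφ : Function.Injective φ)
    (hx : ∀ x, (∀ i, φ (some (i, ⟨s - 1, by omega⟩)) ≠ x) → T.dist (φ none) x < s) :
    mdi T k = Fintype.card V - p + 1 := by
  have hd := isTreeMetric_dist hT
  obtain ⟨L, hL, hLp, hmem⟩ := h.exists_spread hT hs hφ
  have hx' : ∀ x, x ∉ L → T.dist (φ none) x < s := by
    intro x hxL
    rw [hmem] at hxL
    push Not at hxL
    exact hx x hxL
  have hmax : IsMaxSpread (Far T.dist s) univ L := by
    refine ⟨subset_univ _, hL, fun x _ hxL => ?_⟩
    refine ⟨φ (some (⟨0, by omega⟩, ⟨s - 1, by omega⟩)), (hmem _).2 ⟨_, rfl⟩, ?_⟩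
    have h1 := hx' x hxL
    have h2 := (h.dist_none hT hφ ⟨0, by omega⟩ ⟨s - 1, by omega⟩).1
    dsimp only at h2
    have h3 := hd.tri x (φ none) (φ (some (⟨0, by omega⟩, ⟨s - 1, by omega⟩)))
    have := hd.symm x (φ none)
    unfold Far
    omega
  rw [mdi_eq hks, card_maxSpreads_of_split hd.far_symm hmax, hLp, card_univ]
  intro x _ hxL y _ hyL
  have h1 := hx' x hxL
  have h2 := hx' y hyL
  have h3 := hd.tri x (φ none) y
  have := hd.symm x (φ none)
  unfold Far
  omega

theorem mdi_of_contains_doubleStarLike (hT : T.IsTree) (hks : k + 1 = 2 * s) (hs : 1 ≤ s)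
    (hp : 1 ≤ p) (hq : 1 ≤ q) (hpn : (Fintype.card V - 1) / s = p + q) (hD : T.diam = 2 * s + 1)
    (hc : (doubleStarLike p q s).IsContained T) (htw : ¬ ∃ x, IsDiametralTwin T k x) :
    mdi T k = Fintype.card V - (p + q) + 1 := by
  classical
  have hd := isTreeMetric_dist hT
  obtain ⟨⟨f, hf⟩⟩ := hc
  have hφ : IsStarMap T (f ∘ Sum.inl) := (isStarMap_inl p q s).of_hom f
  have hψ : IsStarMap T (f ∘ Sum.inr) := (isStarMap_inr p q s).of_hom f
  obtain ⟨L₁, hL₁, hc₁, hm₁⟩ := hφ.exists_spread hT hs (hf.comp Sum.inl_injective)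
  obtain ⟨L₂, hL₂, hc₂, hm₂⟩ := hψ.exists_spread hT hs (hf.comp Sum.inr_injective)
  have cross : ∀ x ∈ L₁, ∀ y ∈ L₂, T.dist x y = 2 * s + 1 := by
    intro x hx y hy
    obtain ⟨i, rfl⟩ := (hm₁ x).1 hx
    obtain ⟨j, rfl⟩ := (hm₂ y).1 hy
    have := hφ.dist_cross hT hψ (f.map_rel (doubleStarLike_adj_none p q s)) (by
      rw [Sum.elim_comp_inl_inr]
      exact hf) i j ⟨s - 1, by omega⟩ ⟨s - 1, by omega⟩
    dsimp only at this
    omega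
  have hdisj : Disjoint L₁ L₂ := by
    rw [disjoint_left]
    intro x hx hy
    have := cross x hx x hy
    rw [SimpleGraph.dist_self] at this
    omega
  have hL : Spread (Far T.dist s) (L₁ ∪ L₂) := by
    intro x hx y hy hxy
    unfold Far
    rcases mem_union.1 hx with hx | hx <;> rcases mem_union.1 hy with hy | hy
    · exact hL₁ x hx y hy hxy
    · rw [cross x hx y hy]
      omega
    · rw [T.dist_comm, cross y hy x hx]
      omega
    · exact hL₂ x hx y hy hxy
  have hcard : (L₁ ∪ L₂).card = p + q := by rw [card_union_of_disjoint hdisj, hc₁, hc₂]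
  have hmax := isMaxSpread_of_card hT hL hs (by omega) (by omega)
  rw [exists_isDiametralTwin_iff hT hks (by omega) (by omega), not_not, hD] at htw
  have hS := hasDiam_univ hT.connected
  rw [hD] at hS
  obtain ⟨a, ha⟩ := card_pos.1 (show 0 < L₁.card by omega)
  obtain ⟨b, hb⟩ := card_pos.1 (show 0 < L₂.card by omega)
  rw [mdi_eq hks, card_maxSpreads_odd hd hS htw hmax (mem_union_left _ ha) (mem_union_right _ hb)
    (cross a ha b hb), hcard, card_univ]

/-- At diameter `2 * s` every vertex is within `s` of the midpoint of a diametral path, so points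
pairwise `2 * s` apart are at distance exactly `s` from it. -/
theorem contains_starLike (hT : T.IsTree) (hD : T.diam = 2 * s)
    {L : Finset V} (hL : Spread (Far T.dist s) L) (hLp : L.card = p) (hp : 2 ≤ p) :
    (starLike p s).IsContained T := by
  have hd := isTreeMetric_dist hT
  have hS := hasDiam_univ hT.connected
  rw [hD] at hS
  obtain ⟨a, ha, b, hb, hab⟩ := hS.exists_eq
  obtain ⟨c, -, hac, hcb⟩ := isGeodesic_univ hT.connected a ha b hb s (by omega)
  have hcle : ∀ x, T.dist c x ≤ s := by
    intro x
    have h1 := hd.dist_between (x := a) (y := b) (m := c) (by omega) x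
    have h2 := hS.le x (mem_univ _) a ha
    have h3 := hS.le x (mem_univ _) b hb
    have := hd.symm c x
    omega
  have hcL : ∀ x ∈ L, T.dist c x = s := by
    intro x hx
    obtain ⟨y, hy, hne⟩ := exists_mem_ne (show 1 < L.card by omega) x
    have h1 := hL x hx y hy hne.symm
    unfold Far at h1
    have h2 := hd.tri x c y
    have h3 := hcle x
    have h4 := hcle y
    have := hd.symm c x
    omega
  let e := (L.equivFinOfCardEq hLp).symm
  obtain ⟨φ, h1, h2, -⟩ := exists_isStarMap hT (c := c) (l := fun i => (e i : V)) (s := s)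
    (fun i => hcL _ (e i).2) (fun i j hij => hL _ (e i).2 _ (e j).2 fun h => hij
      (e.injective (Subtype.ext h)))
  exact h1.isContained h2

/-- Parity puts each point of `L` at distance `s` from one end of the central edge of the path from
`a` to `b` and `s + 1` from the other. This splits `L` into the two bundles of arms; `a` and `b`
keep both nonempty. -/
theorem contains_doubleStarLike (hT : T.IsTree) {L : Finset V} (hD : T.diam = 2 * s + 1)
    (hL : Spread (Far T.dist s) L) {a b : V} (ha : a ∈ L) (hb : b ∈ L)
    (hab : T.dist a b = 2 * s + 1) :
    ∃ p q, 1 ≤ p ∧ 1 ≤ q ∧ p + q = L.card ∧ (doubleStarLike p q s).IsContained T := by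
  classical
  have hd := isTreeMetric_dist hT
  have hS := hasDiam_univ hT.connected
  rw [hD] at hS
  obtain ⟨g, h0, h1, hadj, hg⟩ := exists_geodesic hT.connected a b
  rw [hab] at h1 hadj hg
  have hcc := hadj s (by omega)
  have ha1 := hg 0 s (by omega) (by omega)
  have ha2 := hg 0 (s + 1) (by omega) (by omega)
  have hb1 := hg s (2 * s + 1) (by omega) (by omega)
  have hb2 := hg (s + 1) (2 * s + 1) (by omega) (by omega)
  rw [h0] at ha1 ha2
  rw [h1] at hb1 hb2
  generalize g s = c₁ at *
  generalize g (s + 1) = c₂ at *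
  have hside : ∀ x ∈ L, (T.dist c₁ x = s ∧ T.dist c₂ x = s + 1) ∨
      (T.dist c₂ x = s ∧ T.dist c₁ x = s + 1) := by
    intro x hx
    have e1 := hd.symm c₁ x
    have e2 := hd.symm c₂ x
    have e3 := hd.symm c₁ a
    have e4 := hd.symm c₂ a
    by_cases hxa : x = a
    · subst hxa
      omega
    by_cases hxb : x = b
    · subst hxb
      omega
    have h2 := hL x hx a ha hxa
    have h3 := hL x hx b hb hxb
    unfold Far at h2 h3
    have h4 := hS.le x (mem_univ _) a (mem_univ _)
    have h5 := hS.le x (mem_univ _) b (mem_univ _)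
    obtain ⟨m, hm⟩ := hd.even x a b
    have h6 := hd.dist_between (x := a) (y := b) (m := c₁) (by omega) x
    have h7 := hd.dist_between (x := a) (y := b) (m := c₂) (by omega) x
    omega
  let L₁ := L.filter fun x => T.dist c₁ x = s
  let L₂ := L.filter fun x => ¬ T.dist c₁ x = s
  have hcard : L₁.card + L₂.card = L.card := card_filter_add_card_filter_not _
  have hL₁ : ∀ x ∈ L₁, x ∈ L ∧ T.dist c₁ x = s ∧ T.dist c₂ x = s + 1 := by
    intro x hx
    obtain ⟨hx, h⟩ := mem_filter.1 hx
    have := hside x hx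
    exact ⟨hx, by omega, by omega⟩
  have hL₂ : ∀ x ∈ L₂, x ∈ L ∧ T.dist c₂ x = s ∧ T.dist c₁ x = s + 1 := by
    intro x hx
    obtain ⟨hx, h⟩ := mem_filter.1 hx
    have := hside x hx
    exact ⟨hx, by omega, by omega⟩
  refine ⟨L₁.card, L₂.card, card_pos.2 ⟨a, mem_filter.2 ⟨ha, ?_⟩⟩,
    card_pos.2 ⟨b, mem_filter.2 ⟨hb, ?_⟩⟩, hcard, ?_⟩
  · rw [T.dist_comm]
    omega
  · omega
  · let e₁ := (L₁.equivFin).symm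
    let e₂ := (L₂.equivFin).symm
    obtain ⟨φ, hφ, hφi, hφ0, hφl⟩ := exists_isStarMap hT (c := c₁) (l := fun i => (e₁ i : V)) (s := s)
      (fun i => (hL₁ _ (e₁ i).2).2.1) (fun i j hij => hL _ (hL₁ _ (e₁ i).2).1 _
        (hL₁ _ (e₁ j).2).1 fun h => hij (e₁.injective (Subtype.ext h)))
    obtain ⟨ψ, hψ, hψi, hψ0, hψl⟩ := exists_isStarMap hT (c := c₂) (l := fun i => (e₂ i : V)) (s := s)
      (fun i => (hL₂ _ (e₂ i).2).2.1) (fun i j hij => hL _ (hL₂ _ (e₂ i).2).1 _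
        (hL₂ _ (e₂ j).2).1 fun h => hij (e₂.injective (Subtype.ext h)))
    refine ⟨⟨⟨Sum.elim φ ψ, fun hab => hφ.doubleStarLike_map_adj hψ (by rwa [hφ0, hψ0]) hab⟩,
      Function.Injective.sumElim hφi hψi ?_⟩⟩
    rintro (_ | ⟨i, j⟩) (_ | ⟨i', j'⟩) h
    · rw [hφ0, hψ0] at h
      exact hcc.ne h
    · have h2 := hψl i' j'
      rw [← h, hφ0] at h2
      have := (hL₂ _ (e₂ i').2).2.2
      omega
    · have h2 := hφl i j
      rw [h, hψ0] at h2
      have := (hL₁ _ (e₁ i).2).2.2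
      omega
    · have h2 := hφl i j
      have h3 := hψl i' j'
      rw [h] at h2
      have h4 := (hL₁ _ (e₁ i).2)
      have h5 := (hL₂ _ (e₂ i').2)
      have h6 := hL _ h4.1 _ h5.1 (by
        intro he
        rw [he] at h4
        omega)
      unfold Far at h6
      have h7 := hd.tri (e₁ i) (ψ (some (i', j'))) (e₂ i')
      have h8 := hd.symm (e₁ i : V) (ψ (some (i', j')))
      omega

end Extremal

/-! ### The minimum and its attainment -/

section Final

universe u
variable {V : Type u} [Fintype V] {T : SimpleGraph V} {k s p : ℕ}

theorem dist_lt_card (hT : T.Connected) (x y : V) : T.dist x y < Fintype.card V := by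
  classical
  obtain ⟨p, hp, hl⟩ := hT.exists_path_of_dist x y
  rw [← hl]
  exact hp.length_lt

theorem mdi_of_diam_lt (hT : T.IsTree) (hks : k + 1 = 2 * s) (hD : T.diam < 2 * s) :
    mdi T k = Fintype.card V := by
  have := hT.connected.nonempty
  rw [mdi_eq hks, card_maxSpreads_of_small (isTreeMetric_dist hT) univ_nonempty, card_univ]
  intro x hx y hy
  exact ((hasDiam_univ hT.connected).le x hx y hy).trans_lt hD

theorem mdi_of_card_le (hT : T.IsTree) (hks : k + 1 = 2 * s) (hV : Fintype.card V ≤ k + 1) :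
    mdi T k = Fintype.card V := by
  refine mdi_of_diam_lt hT hks ?_
  obtain ⟨x, -, y, -, h⟩ := (hasDiam_univ hT.connected).exists_eq
  have := dist_lt_card hT.connected x y
  omega

theorem f_eq_lowerBound (hks : k + 1 = 2 * s) {n : ℕ} (hn : k + 2 ≤ n) :
    f k n = lowerBound s n := by
  rw [f, if_neg (by omega), lowerBound, show k % 2 = 1 by omega, show k / 2 + 1 = s by omega]

theorem lowerBound_lt (hs : 1 ≤ s) {n : ℕ} (hn : 2 * s + 1 ≤ n) : lowerBound s n < n := by
  unfold lowerBound
  have : 2 ≤ (n - 1) / s := (Nat.le_div_iff_mul_le (by omega)).2 (by omega)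
  omega

theorem lowerBound_le_mdi (hT : T.IsTree) (hks : k + 1 = 2 * s) (hs : 1 ≤ s)
    (hV : k + 2 ≤ Fintype.card V) : lowerBound s (Fintype.card V) ≤ mdi T k := by
  rcases Nat.lt_or_ge T.diam (2 * s) with h | h
  · rw [mdi_of_diam_lt hT hks h]
    exact (lowerBound_lt hs (by omega)).le
  · rw [mdi_eq hks, ← card_univ]
    exact (boundHolds (isTreeMetric_dist hT) hs (isGeodesic_univ hT.connected)
      (hasDiam_univ hT.connected) h).1

theorem eq_of_le_lowerBound {n c : ℕ} (hs : 1 ≤ s) (hcn : c * s + 1 ≤ n)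
    (h : n - c + 1 ≤ lowerBound s n) : c = (n - 1) / s := by
  have h1 : c ≤ (n - 1) / s := (Nat.le_div_iff_mul_le (by omega)).2 (by omega)
  have h2 : (n - 1) / s ≤ n - 1 := Nat.div_le_self _ _
  unfold lowerBound at h
  omega

/-- The structure of the trees that attain the lower bound. -/
theorem structure_of_mdi_le (hT : T.IsTree) (hks : k + 1 = 2 * s) (hs : 1 ≤ s)
    (hV : k + 2 ≤ Fintype.card V) (hp : (Fintype.card V - 1) / s = p)
    (h : mdi T k ≤ lowerBound s (Fintype.card V)) :
    (T.diam = 2 * s ∧ (starLike p s).IsContained T ∧ ¬ ∃ x y, IsSpecialPair T k x y) ∨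
    (T.diam = 2 * s + 1 ∧ p * s + 2 ≤ Fintype.card V ∧ (¬ ∃ x, IsDiametralTwin T k x) ∧
      ∃ p₁ p₂, 1 ≤ p₁ ∧ 1 ≤ p₂ ∧ p₁ + p₂ = p ∧ (doubleStarLike p₁ p₂ s).IsContained T) := by
  classical
  have hd := isTreeMetric_dist hT
  have hS := hasDiam_univ hT.connected
  have hg := isGeodesic_univ hT.connected
  rcases Nat.lt_or_ge T.diam (2 * s) with hD | hD
  · rw [mdi_of_diam_lt hT hks hD] at h
    exact absurd h (not_le.2 (lowerBound_lt hs (by omega)))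
  have hstrict := (boundHolds hd hs hg hS hD).2
  rw [card_univ, ← mdi_eq hks] at hstrict
  have hns : ¬ IsStrict T.dist univ s T.diam := fun hs => absurd h (not_le.2 (hstrict hs))
  simp only [IsStrict, not_or, not_le, not_and, not_not] at hns
  obtain ⟨hlt, hodd, heven⟩ := hns
  obtain ⟨a, ha, b, hb, hab⟩ := hS.exists_eq
  obtain ⟨L, hL, haL, hbL⟩ := exists_isMaxSpread_pair (s := s) hd ha hb (by omega)
  have hL2 : 2 ≤ L.card := one_lt_card.2 ⟨a, haL, b, hbL, hd.ne (by omega)⟩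
  rcases Nat.lt_or_ge T.diam (2 * s + 1) with hD' | hD'
  · have hD2 : T.diam = 2 * s := by omega
    have hsp := heven hD2
    refine Or.inl ⟨hD2, ?_, ?_⟩
    · have hsp' := hsp
      rw [hD2] at hS hsp'
      have h1 := card_maxSpreads_even hd hS hsp' hL hL2
      have h2 := packing hd hg hL.subset hL.spread hL2
      rw [← mdi_eq hks, card_univ] at h1
      rw [card_univ] at h2
      have h3 := eq_of_le_lowerBound hs h2 (h1 ▸ h)
      exact contains_starLike hT hD2 hL.spread (h3.trans hp) (by omega)
    · rwa [exists_isSpecialPair_iff hT hks (by omega) (by omega), not_not]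
  · have hD2 : T.diam = 2 * s + 1 := by omega
    have htf := hodd hD2
    have htf' := htf
    rw [hD2] at hS htf' hab
    have h1 := card_maxSpreads_odd hd hS htf' hL haL hbL hab
    have h2 := packing_odd hd hg hL.subset hL.spread haL hbL hab
    rw [← mdi_eq hks, card_univ] at h1
    rw [card_univ] at h2
    have h3 := eq_of_le_lowerBound hs (by omega) (h1 ▸ h)
    rw [hp] at h3
    refine Or.inr ⟨hD2, h3 ▸ h2, ?_, h3 ▸ contains_doubleStarLike hT hD2 hL.spread haL hbL hab⟩
    rwa [exists_isDiametralTwin_iff hT hks (by omega) (by omega), not_not]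

/-- A tree with the vertex count of a tree that it contains is isomorphic to it. -/
theorem nonempty_iso_of_isContained {W : Type*} {G : SimpleGraph W} (hG : G.IsTree) (hT : T.IsTree)
    [Fintype W] (hcard : Fintype.card W = Fintype.card V) (h : G.IsContained T) :
    Nonempty (T ≃g G) := by
  obtain ⟨⟨φ, hφ⟩⟩ := h
  let e : W ≃ V := Equiv.ofBijective φ ((Fintype.bijective_iff_injective_and_card φ).2 ⟨hφ, hcard⟩)
  let i : T.comap e ≃g T := SimpleGraph.Iso.comap e T
  have hle : G ≤ T.comap e := fun a b hab => φ.map_rel hab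
  -- A tree is a minimal connected graph, so a connected spanning subgraph of it is the whole tree.
  have hmin := (SimpleGraph.isTree_iff_minimal_connected.1 (i.isTree_iff.2 hT))
  have heq : G = T.comap e := hle.antisymm (hmin.le_of_le hG.connected hle)
  rw [heq]
  exact ⟨i.symm⟩

theorem mdi_of_iso_starLike (hks : k + 1 = 2 * s) (hs : 1 ≤ s) (hp : 2 ≤ p)
    (i : T ≃g starLike p s) : T.IsTree ∧ mdi T k = Fintype.card V - p + 1 := by
  have hT : T.IsTree := i.isTree_iff.2 (starLike_isTree p s)
  have hφ : IsStarMap T (i.symm ∘ id) := (isStarMap_id p s).of_hom i.symm.toHom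
  refine ⟨hT, mdi_of_starMap hT hks hs hp hφ i.symm.injective fun x hx => ?_⟩
  obtain ⟨y, rfl⟩ := i.symm.surjective x
  rcases y with _ | ⟨a, j, hj⟩
  · simp
    omega
  · have h1 := (hφ.dist_none hT i.symm.injective a ⟨j, hj⟩).1
    have h2 : j ≠ s - 1 := by
      rintro rfl
      exact hx a rfl
    simp only [Function.comp, id] at h1 ⊢
    omega

/-- The star-like tree with `r` additional leaves at the centre. -/
def starWithLeaves (p m r : ℕ) : SimpleGraph (Option (Fin p × Fin m) ⊕ Fin r) :=
  SimpleGraph.fromRel fun x y =>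
    match x, y with
    | Sum.inl a, Sum.inl b => (starLike p m).Adj a b
    | Sum.inl none, Sum.inr _ => True
    | _, _ => False

theorem starWithLeaves_adj_inl {m r : ℕ} {a b : Option (Fin p × Fin m)} :
    (starWithLeaves p m r).Adj (Sum.inl a) (Sum.inl b) ↔ (starLike p m).Adj a b := by
  rw [starWithLeaves, SimpleGraph.fromRel_adj]
  constructor
  · rintro ⟨-, h | h⟩
    · exact h
    · exact h.symm
  · intro h
    exact ⟨fun e => h.ne (Sum.inl_injective e), Or.inl h⟩

theorem starWithLeaves_adj_inr {m r : ℕ} {a : Option (Fin p × Fin m)} {b : Fin r} :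
    (starWithLeaves p m r).Adj (Sum.inl a) (Sum.inr b) ↔ a = none := by
  rw [starWithLeaves, SimpleGraph.fromRel_adj]
  rcases a with _ | a <;> simp

theorem starWithLeaves_isTree (p m r : ℕ) : (starWithLeaves p m r).IsTree := by
  refine isTree_of_parent (Sum.inl none)
    (Sum.elim (fun a => Sum.inl (starParent p m a)) (fun _ => Sum.inl none))
    (Sum.elim (starDepth p m) (fun _ => 1)) ?_ ?_ ?_
  · rintro (a | a) hw
    · exact starWithLeaves_adj_inl.2 (starLike_adj_starParent a fun h => hw (by rw [h]))
    · exact (starWithLeaves_adj_inr.2 rfl).symm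
  · rintro (a | a) hw
    · exact starDepth_starParent_lt a fun h => hw (by rw [h])
    · simp [starDepth]
  · rintro (a | a) (b | b) hab
    · simpa using eq_starParent_of_adj (starWithLeaves_adj_inl.1 hab)
    · right
      simpa using starWithLeaves_adj_inr.1 hab
    · left
      simpa using starWithLeaves_adj_inr.1 hab.symm
    · simp [starWithLeaves] at hab

/-- The surplus `r` vertices are hung on the centre as leaves. They are at distance `1 < s` from it,
which is where `2 ≤ s` is needed. -/
theorem exists_tree_mdi_eq_lowerBound (hks : k + 1 = 2 * s) (hs : 2 ≤ s)
    (hV : k + 2 ≤ Fintype.card V) :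
    ∃ T : SimpleGraph V, T.IsTree ∧ mdi T k = lowerBound s (Fintype.card V) := by
  obtain ⟨p, hp⟩ : ∃ p, (Fintype.card V - 1) / s = p := ⟨_, rfl⟩
  obtain ⟨r, hr⟩ : ∃ r, (Fintype.card V - 1) % s = r := ⟨_, rfl⟩
  have hdm := Nat.div_add_mod' (Fintype.card V - 1) s
  rw [hp, hr] at hdm
  have hp2 : 2 ≤ p := hp ▸ (Nat.le_div_iff_mul_le (by omega)).2 (by omega)
  have hcard : Fintype.card V = Fintype.card (Option (Fin p × Fin s) ⊕ Fin r) := by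
    simp only [Fintype.card_sum, Fintype.card_option, Fintype.card_prod, Fintype.card_fin]
    omega
  let e : V ≃ Option (Fin p × Fin s) ⊕ Fin r := Fintype.equivOfCardEq hcard
  let i : (starWithLeaves p s r).comap e ≃g starWithLeaves p s r := SimpleGraph.Iso.comap e _
  have hT := i.isTree_iff.2 (starWithLeaves_isTree p s r)
  refine ⟨_, hT, ?_⟩
  have hψ : IsStarMap (starWithLeaves p s r) Sum.inl :=
    ⟨fun a h => starWithLeaves_adj_inl.2 ((isStarMap_id p s).adj_none a h),
      fun a j h => starWithLeaves_adj_inl.2 ((isStarMap_id p s).adj_some a j h)⟩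
  have hφ := hψ.of_hom i.symm.toHom
  have hinj : Function.Injective (i.symm.toHom ∘ (Sum.inl : Option (Fin p × Fin s) → _)) :=
    i.symm.injective.comp Sum.inl_injective
  rw [lowerBound, hp]
  refine mdi_of_starMap hT hks (by omega) hp2 hφ hinj fun x hx => ?_
  obtain ⟨y, rfl⟩ := i.symm.surjective x
  rcases y with (_ | ⟨a, j, hj⟩) | y
  · have : ((SimpleGraph.comap e (starWithLeaves p s r)).dist (i.symm (Sum.inl none))
      (i.symm (Sum.inl none))) < s := by
      rw [SimpleGraph.dist_self]
      omega
    exact this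
  · have h1 := (hφ.dist_none hT hinj a ⟨j, hj⟩).1
    have h2 : j ≠ s - 1 := by
      rintro rfl
      exact hx a rfl
    dsimp only at h1
    refine lt_of_eq_of_lt h1 ?_
    omega
  · have h1 : (starWithLeaves p s r).Adj (Sum.inl none) (Sum.inr y) :=
      starWithLeaves_adj_inr.2 rfl
    refine lt_of_eq_of_lt (SimpleGraph.dist_eq_one_iff_adj.2 (i.symm.map_adj_iff.2 h1)) ?_
    omega

theorem exists_tree_mdi_eq (hks : k + 1 = 2 * s) (hs : 2 ≤ s) (hV : 1 ≤ Fintype.card V) :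
    ∃ T : SimpleGraph V, T.IsTree ∧ mdi T k = f k (Fintype.card V) := by
  rcases Nat.lt_or_ge (Fintype.card V) (k + 2) with h | h
  · have : Nonempty V := Fintype.card_pos_iff.1 hV
    obtain ⟨T, -, hT⟩ := (SimpleGraph.connected_top (V := V)).exists_isTree_le
    refine ⟨T, hT, ?_⟩
    rw [mdi_of_card_le hT hks (by omega), f, if_pos (by omega)]
  · rw [f_eq_lowerBound hks h]
    exact exists_tree_mdi_eq_lowerBound hks hs h

theorem f_le_mdi (hT : T.IsTree) (hks : k + 1 = 2 * s) (hs : 1 ≤ s) :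
    f k (Fintype.card V) ≤ mdi T k := by
  rcases Nat.lt_or_ge (Fintype.card V) (k + 2) with h | h
  · rw [mdi_of_card_le hT hks (by omega), f, if_pos (by omega)]
  · rw [f_eq_lowerBound hks h]
    exact lowerBound_le_mdi hT hks hs h

theorem isKMinimal_iff (hks : k + 1 = 2 * s) (hs : 2 ≤ s) (hV : 1 ≤ Fintype.card V) :
    IsKMinimal k T ↔ T.IsTree ∧ mdi T k = f k (Fintype.card V) := by
  obtain ⟨T₀, hT₀, h₀⟩ := exists_tree_mdi_eq hks hs hV
  constructor
  · rintro ⟨hT, h⟩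
    exact ⟨hT, le_antisymm (h₀ ▸ h T₀ hT₀) (f_le_mdi hT hks (by omega))⟩
  · rintro ⟨hT, h⟩
    exact ⟨hT, fun T' hT' => h ▸ f_le_mdi hT' hks (by omega)⟩

end Final

end DistIndep

theorem theorem3 (k n : ℕ) (hk_odd : Odd k) (hk : 3 ≤ k) (hn : 1 ≤ n)
    (V : Type*) [Fintype V] (hV : Fintype.card V = n) :
    -- the minimum is `f_k(n)`, and it is attained exactly by the `k`-minimal trees
    IsLeast {m : ℕ | ∃ T : SimpleGraph V, T.IsTree ∧ DistIndep.mdi T k = m} (DistIndep.f k n) ∧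
    (∀ T : SimpleGraph V, DistIndep.IsKMinimal k T → DistIndep.mdi T k = DistIndep.f k n) ∧
    -- (i)
    (n ≤ k + 1 → ∀ T : SimpleGraph V, T.IsTree → DistIndep.IsKMinimal k T) ∧
    -- (ii)
    (k + 2 ≤ n → (k / 2 + 1) ∣ (n - 1) →
      ∀ T : SimpleGraph V, DistIndep.IsKMinimal k T ↔
        Nonempty (T ≃g DistIndep.starLike ((n - 1) / (k / 2 + 1)) (k / 2 + 1))) ∧
    -- (iii)
    (k + 2 ≤ n → ¬ (k / 2 + 1) ∣ (n - 1) →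
      {T : SimpleGraph V | DistIndep.IsKMinimal k T} =
        DistIndep.AddStar V k (DistIndep.starLike ((n - 1) / (k / 2 + 1)) (k / 2 + 1))
            ((n - 1) % (k / 2 + 1)) ∪
          DistIndep.AddB V k ((n - 1) / (k / 2 + 1)) (k / 2 + 1)
            ((n - 1) % (k / 2 + 1) - 1)) := by
  open DistIndep in
  obtain ⟨t, ht⟩ := hk_odd
  obtain ⟨s, hs⟩ : ∃ s, k / 2 + 1 = s := ⟨_, rfl⟩
  rw [hs]
  have hks : k + 1 = 2 * s := by omega
  have hs2 : 2 ≤ s := by omega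
  obtain ⟨p, hp⟩ : ∃ p, (n - 1) / s = p := ⟨_, rfl⟩
  obtain ⟨r, hr⟩ : ∃ r, (n - 1) % s = r := ⟨_, rfl⟩
  have hdm := Nat.div_add_mod' (n - 1) s
  have hdvd : s ∣ n - 1 ↔ r = 0 := by rw [Nat.dvd_iff_mod_eq_zero, hr]
  rw [hp, hr] at hdm ⊢
  have hp2 : k + 2 ≤ n → 2 ≤ p := fun h => hp ▸ (Nat.le_div_iff_mul_le (by omega)).2 (by omega)
  subst hV
  refine ⟨⟨exists_tree_mdi_eq hks hs2 hn, ?_⟩, fun T hT => ((isKMinimal_iff hks hs2 hn).1 hT).2,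
    fun hle T hT => ?_, fun hge hd T => ?_, fun hge hd => ?_⟩
  · rintro m ⟨T, hT, rfl⟩
    exact f_le_mdi hT hks (by omega)
  · rw [isKMinimal_iff hks hs2 hn, mdi_of_card_le hT hks hle, f, if_pos hle]
    exact ⟨hT, rfl⟩
  · rw [isKMinimal_iff hks hs2 hn, f_eq_lowerBound hks hge]
    rw [hdvd] at hd
    constructor
    · rintro ⟨hT, h⟩
      rcases structure_of_mdi_le hT hks (by omega) hge hp h.le with ⟨-, hc, -⟩ | ⟨-, h1, -⟩
      · refine nonempty_iso_of_isContained (starLike_isTree p s) hT ?_ hc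
        simp only [Fintype.card_option, Fintype.card_prod, Fintype.card_fin]
        omega
      -- A double star-like subtree needs `p * s + 2` vertices, but here `n = p * s + 1`.
      · omega
    · rintro ⟨i⟩
      rw [lowerBound, hp]
      exact mdi_of_iso_starLike hks (by omega) (hp2 hge) i
  · rw [hdvd] at hd
    ext T
    rw [Set.mem_union, Set.mem_ofPred_eq, isKMinimal_iff hks hs2 hn, f_eq_lowerBound hks hge]
    constructor
    · rintro ⟨hT, h⟩
      rcases structure_of_mdi_le hT hks (by omega) hge hp h.le with
        ⟨hD, hc, hsp⟩ | ⟨hD, -, htw, p₁, p₂, h₁, h₂, h₁₂, hc⟩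
      · refine Or.inl ⟨hT, ?_, ?_, hc, hsp⟩
        · simp only [Nat.card_eq_fintype_card, Fintype.card_option, Fintype.card_prod,
            Fintype.card_fin]
          omega
        · rw [hD, diam_starLike (hp2 hge) (by omega)]
      · refine Or.inr ⟨p₁, p₂, h₁, h₂, h₁₂, hT, ?_, ?_, hc, htw⟩
        · simp only [Nat.card_eq_fintype_card, Fintype.card_sum, Fintype.card_option,
            Fintype.card_prod, Fintype.card_fin]
          rw [← h₁₂, add_mul] at hdm
          omega
        · rw [hD, diam_doubleStarLike h₁ h₂ (by omega)]
    · rw [lowerBound, hp]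
      rintro (⟨hT, -, hD, hc, hsp⟩ | ⟨p₁, p₂, h₁, h₂, h₁₂, hT, -, hD, hc, htw⟩)
      · rw [diam_starLike (hp2 hge) (by omega)] at hD
        exact ⟨hT, mdi_of_contains_starLike hT hks (by omega) (hp2 hge) hp hD hc hsp⟩
      · rw [diam_doubleStarLike h₁ h₂ (by omega)] at hD
        subst h₁₂
        exact ⟨hT, mdi_of_contains_doubleStarLike hT hks (by omega) h₁ h₂ hp hD hc htw⟩
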